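/- Let $\mathbb K$ be a field of characteristic zero and let $\Gamma=(V,E,s,t)$ be a multiquiver: $V$ and $E$ are arbitrary sets and $s,t:E\to (V\times\mathbb Z_{>0})\cup\{\emptyset\}$ are maps such that $s(e)=(u,m)$, $t(e)=(v,n)$ imply $u\ne v$, and such that each $v\in V$ is the source or target of only finitely many edges. Put $\gamma_{ev}=n$ if $t(e)=(v,n)$, $\gamma_{ev}=-n$ if $s(e)=(v,n)$, and $\gamma_{ev}=0$ otherwise (when $v$ is not incident to $e$). Let $R=\mathbb K[u_e\mid e\in E]$, let $\sigma_v$ $(v\in V)$ be the automorphism of $R$ with $\sigma_v(u_e)=u_e-\gamma_{ev}$, and let $t_v=\prod_{e} u_{ev}$, the product over the edges incident to $v$, where $u_{ev}=u_e(u_e+1)\cdots(u_e+n-1)$ if $t(e)=(v,n)$ and $u_{ev}=(u_e-1)(u_e-2)\cdots(u_e-n)$ if $s(e)=(v,n)$. Let $\mathcal C$ be the ring generated by $R$ and symbols $X_v,Y_v$ $(v\in V)$ with relations $X_v r=\sigma_v(r)X_v$, $Y_v r=\sigma_v^{-1}(r)Y_v$ $(r\in R)$, $Y_vX_v=t_v$,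 $X_vY_v=\sigma_v(t_v)$, and $X_vY_w=Y_wX_v$ for $v\ne w$. It is $\mathbb ZV$-graded by $\deg r=0$, $\deg X_v=v$, $\deg Y_v=-v$. Let $\mathcal A(\Gamma)$ be the quotient of $\mathcal C$ by the sum of all graded two-sided ideals that meet the degree zero component $\mathcal C_0$ only in $0$, with the induced $\mathbb ZV$-grading (this is the twisted generalized Weyl algebra of $\Gamma$). Let $C=(a_{ij})_{i,j\in V}$ be the generalized Cartan matrix of the Dynkin diagram $D(\Gamma)$: $a_{ii}=2$ and, for $i\ne j$, $a_{ij}=-\sum_e|\gamma_{ej}|$, the sum over the edges $e$ between $i$ and $j$. Let $\mathfrak h$ be a $\mathbb K$-vector space with linearly independent simple coroots $\alpha_i^\vee\in\mathfrak h$ and linearly independent simple roots $\alpha_i\in\mathfrak h^*$ $(i\in V)$ such that $\alpha_j(\alpha_i^\vee)=a_{ij}$. Let $\mathfrak g$ be the associated Kac–Moody algebra, i.e. the Lie algebra generated by the vector space $\mathfrak h$ and elements $e_i,f_i$ $(i\in V)$ subject to $$[h,h']=0,\quad [e_i,f_j]=\delta_{ij}\alpha_i^\vee,\quad [h,e_i]=\alpha_i(h)e_i,\quad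 [h,f_i]=-\alpha_i(h)f_i\qquad(h,h'\in\mathfrak h),$$ $$(\operatorname{ad}e_i)^{1-a_{ij}}e_j=0=(\operatorname{ad}f_i)^{1-a_{ij}}f_j\qquad(i\neq j).$$ Let $\mathfrak n^+$ and $\mathfrak n^-$ be the subalgebras of $\mathfrak g$ generated by the $e_i$ and by the $f_i$, respectively. For $\beta=\sum_i d_i\alpha_i$ with $d=(d_i)\in\mathbb ZV$, let $U(\mathfrak n^\pm)_\beta$ be the space of weight $\beta$ for the adjoint action of $\mathfrak h$ on $U(\mathfrak n^\pm)$. **Theorem 5.4.** There exist homomorphisms of unital $\mathbb K$-algebras $$\psi^+:U(\mathfrak n^+)\to\mathcal A(\Gamma),\ e_i\mapsto X_i,\qquad \psi^-:U(\mathfrak n^-)\to\mathcal A(\Gamma),\ f_i\mapsto Y_i\qquad(i\in V),$$ which are graded: $\psi^\pm\big(U(\mathfrak n^\pm)_{\sum_i d_i\alpha_i}\big)\subseteq\mathcal A(\Gamma)_d$ for all $d\in\mathbb ZV$. Moreover, for all $i,j\in V$ with $i\ne j$ and all integers $k$ with $0\le k\le -a_{ij}$, the restrictions $$\psi^+|_{U(\mathfrak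 n^+)_{k\alpha_i+\alpha_j}}\qquad\text{and}\qquad\psi^-|_{U(\mathfrak n^-)_{-k\alpha_i-\alpha_j}}$$ are injective. -/

import Mathlib

/-! ### Twisted generalized Weyl algebras -/

/-- A twisted generalized Weyl datum `(R, σ, t)` over `K` with index set `I`: commuting
`K`-algebra automorphisms `σ i` of `R` and nonzero central elements `t i` of `R`. -/
structure TGWDatum (K R I : Type*) [Field K] [Ring R] [Algebra K R] where
  σ : I → (R ≃ₐ[K] R)
  t : I → R
  σ_comm : ∀ i j r, σ i (σ j r) = σ j (σ i r)
  t_ne_zero : ∀ i, t i ≠ 0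
  t_central : ∀ i r, t i * r = r * t i

namespace TGWDatum

/-- Generators of the twisted generalized Weyl construction: the elements of the base ring `R` and
the symbols `X i`, `Y i`. -/
inductive Gen (R I : Type*)
  | coeff (r : R) : Gen R I
  | X (i : I) : Gen R I
  | Y (i : I) : Gen R I

/-- The degree of a generator in the free abelian group on `I`. -/
noncomputable def Gen.deg {R I : Type*} : Gen R I → (I →₀ ℤ)
  | .coeff _ => 0
  | .X i => Finsupp.single i 1
  | .Y i => Finsupp.single i (-1)

variable {K R I : Type*} [Field K] [Ring R] [Algebra K R]

/-- Abbreviation for the generators inside the free algebra. -/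
def Gen.free (K : Type*) {R I : Type*} [Field K] (g : Gen R I) : FreeAlgebra K (Gen R I) :=
  FreeAlgebra.ι K g

/-- Defining relations of the twisted generalized Weyl construction. The first three say that
`R` maps to the quotient by a `K`-algebra homomorphism (so that the quotient by them is the free
`R`-ring on the `X i`, `Y i`, with scalars of `K` made central, which the commutation
relations force anyway); the others are the relations of the construction. -/
inductive Rel (D : TGWDatum K R I) (μ : I → I → Kˣ) :
    FreeAlgebra K (Gen R I) → FreeAlgebra K (Gen R I) → Prop
  | coeff_add (r s : R) : Rel D μ (Gen.free K (.coeff (r + s)))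
      (Gen.free K (.coeff r) + Gen.free K (.coeff s))
  | coeff_mul (r s : R) : Rel D μ (Gen.free K (.coeff (r * s)))
      (Gen.free K (.coeff r) * Gen.free K (.coeff s))
  | coeff_scalar (c : K) : Rel D μ (Gen.free K (.coeff (algebraMap K R c)))
      (algebraMap K (FreeAlgebra K (Gen R I)) c)
  | X_coeff (i : I) (r : R) : Rel D μ (Gen.free K (.X i) * Gen.free K (.coeff r))
      (Gen.free K (.coeff (D.σ i r)) * Gen.free K (.X i))
  | Y_coeff (i : I) (r : R) : Rel D μ (Gen.free K (.Y i) * Gen.free K (.coeff r))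
      (Gen.free K (.coeff ((D.σ i).symm r)) * Gen.free K (.Y i))
  | Y_X (i : I) : Rel D μ (Gen.free K (.Y i) * Gen.free K (.X i)) (Gen.free K (.coeff (D.t i)))
  | X_Y (i : I) : Rel D μ (Gen.free K (.X i) * Gen.free K (.Y i))
      (Gen.free K (.coeff (D.σ i (D.t i))))
  | X_Y_ne (i j : I) (h : i ≠ j) : Rel D μ (Gen.free K (.X i) * Gen.free K (.Y j))
      ((μ i j : K) • (Gen.free K (.Y j) * Gen.free K (.X i)))

/-- The twisted generalized Weyl construction. -/
abbrev Construction (D : TGWDatum K R I) (μ : I → I → Kˣ) := RingQuot (D.Rel μ)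

/-- The image of a generator in the twisted generalized Weyl construction. -/
noncomputable def cgen (D : TGWDatum K R I) (μ : I → I → Kˣ) (g : Gen R I) : D.Construction μ :=
  RingQuot.mkAlgHom K (D.Rel μ) (Gen.free K g)

/-- The homogeneous component of degree `d` of the twisted generalized Weyl construction: the span
of all products of generators of total degree `d`. -/
def cdeg (D : TGWDatum K R I) (μ : I → I → Kˣ) (d : I →₀ ℤ) : Submodule K (D.Construction μ) :=
  Submodule.span K
    {x | ∃ l : List (Gen R I), (l.map Gen.deg).sum = d ∧ x = (l.map (D.cgen μ)).prod}

/-- A two-sided ideal is graded if each of its elements is a sum of homogeneous elements of the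
ideal. -/
def IsGraded (D : TGWDatum K R I) (μ : I → I → Kˣ) (J : TwoSidedIdeal (D.Construction μ)) : Prop :=
  ∀ x ∈ J, x ∈ AddSubgroup.closure {y | y ∈ J ∧ ∃ d, y ∈ D.cdeg μ d}

/-- The sum of all graded ideals having zero intersection with the degree zero component. -/
def radical (D : TGWDatum K R I) (μ : I → I → Kˣ) : TwoSidedIdeal (D.Construction μ) :=
  sSup {J | D.IsGraded μ J ∧ ∀ x ∈ J, x ∈ D.cdeg μ 0 → x = 0}

/-- The twisted generalized Weyl algebra. -/
abbrev TGWAlgebra (D : TGWDatum K R I) (μ : I → I → Kˣ) := (D.radical μ).ringCon.Quotient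

/-- The canonical projection from the construction to the algebra. -/
noncomputable def proj (D : TGWDatum K R I) (μ : I → I → Kˣ) :
    D.Construction μ →ₐ[K] D.TGWAlgebra μ :=
  RingCon.mkₐ K (D.radical μ).ringCon

/-- The element `X i` of the twisted generalized Weyl algebra. -/
noncomputable def X (D : TGWDatum K R I) (μ : I → I → Kˣ) (i : I) : D.TGWAlgebra μ :=
  D.proj μ (D.cgen μ (.X i))

/-- The element `Y i` of the twisted generalized Weyl algebra. -/
noncomputable def Y (D : TGWDatum K R I) (μ : I → I → Kˣ) (i : I) : D.TGWAlgebra μ :=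
  D.proj μ (D.cgen μ (.Y i))

/-- The homogeneous component of degree `d` of the twisted generalized Weyl algebra. -/
noncomputable def deg (D : TGWDatum K R I) (μ : I → I → Kˣ) (d : I →₀ ℤ) :
    Submodule K (D.TGWAlgebra μ) :=
  (D.cdeg μ d).map (D.proj μ).toLinearMap

end TGWDatum

/-! ### Multiquivers and their algebras -/

/-- A multiquiver with vertex set `V` and edge set `E`. The value `none` of `s` or `t` means that
the edge has no source, respectively no target. -/
structure Multiquiver (V E : Type*) where
  s : E → Option (V × ℕ+)
  t : E → Option (V × ℕ+)
  no_loops : ∀ e u v m n, s e = some (u, m) → t e = some (v, n) → u ≠ v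
  finite_s : ∀ v, {e | ∃ n, s e = some (v, n)}.Finite
  finite_t : ∀ v, {e | ∃ n, t e = some (v, n)}.Finite

namespace Multiquiver

open Classical in
/-- The multiplicity of an end of an edge at the vertex `v` (zero if that end is not at `v`). -/
noncomputable def endMult {V : Type*} (v : V) : Option (V × ℕ+) → ℕ
  | none => 0
  | some (w, n) => if w = v then (n : ℕ) else 0

variable {V E : Type*} (Γ : Multiquiver V E)

/-- The entry `γ_{ev}` of the incidence matrix. -/
noncomputable def incidence (e : E) (v : V) : ℤ :=
  (endMult v (Γ.t e) : ℤ) - (endMult v (Γ.s e) : ℤ)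

/-- The vertex `v` is incident to the edge `e`. -/
def Incident (e : E) (v : V) : Prop :=
  (∃ n, Γ.s e = some (v, n)) ∨ (∃ n, Γ.t e = some (v, n))

lemma finite_incident (v : V) : {e | Γ.Incident e v}.Finite :=
  (Γ.finite_s v).union (Γ.finite_t v)

/-- The finite set of edges incident to `v`. -/
noncomputable def edgesAt (v : V) : Finset E := (Γ.finite_incident v).toFinset

open Classical in
/-- The generalized Cartan matrix of the Dynkin diagram of the multiquiver: leaves and orientations
are forgotten, and the edges between two distinct vertices `i`, `j` (the edges incident to both)
are merged by adding their multiplicities, so that `- a i j` is the sum of the multiplicities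
at `j`. -/
noncomputable def cartan (i j : V) : ℤ :=
  if i = j then 2 else - ∑ e ∈ Γ.edgesAt i ∩ Γ.edgesAt j, |Γ.incidence e j|

variable (K : Type*) [Field K]

/-- The automorphism `u_e ↦ u_e - γ_{ev}` of the polynomial algebra. -/
noncomputable def sigma (v : V) : MvPolynomial E K ≃ₐ[K] MvPolynomial E K :=
  AlgEquiv.ofAlgHom
    (MvPolynomial.aeval fun e => MvPolynomial.X e - MvPolynomial.C (Γ.incidence e v : K))
    (MvPolynomial.aeval fun e => MvPolynomial.X e + MvPolynomial.C (Γ.incidence e v : K))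
    (by ext e; simp) (by ext e; simp)

/-- The factor `u_{ev}`: it is `u_e (u_e + 1) ⋯ (u_e + n - 1)` if `e` has target `v` with
multiplicity `n`, and `(u_e - 1) ⋯ (u_e - n)` if `e` has source `v` with multiplicity `n`
(since there are no loops, at most one of the two products below is nonempty). -/
noncomputable def uFactor (e : E) (v : V) : MvPolynomial E K :=
  (∏ k ∈ Finset.range (endMult v (Γ.t e)), (MvPolynomial.X e + MvPolynomial.C (k : K))) *
    ∏ k ∈ Finset.range (endMult v (Γ.s e)), (MvPolynomial.X e - MvPolynomial.C ((k : K) + 1))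

/-- The element `t_v`. -/
noncomputable def tElem (v : V) : MvPolynomial E K := ∏ e ∈ Γ.edgesAt v, Γ.uFactor K e v

lemma tElem_ne_zero (v : V) : Γ.tElem K v ≠ 0 := by
  have key : ∀ (e : E) (c : K), (MvPolynomial.X e + MvPolynomial.C c : MvPolynomial E K) ≠ 0 := by
    intro e c h
    have h2 := congrArg (MvPolynomial.eval fun _ => 1 - c) h
    simp at h2
  refine Finset.prod_ne_zero_iff.2 fun e _ => mul_ne_zero ?_ ?_
  · exact Finset.prod_ne_zero_iff.2 fun k _ => key e k
  · refine Finset.prod_ne_zero_iff.2 fun k _ => ?_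
    rw [sub_eq_add_neg, ← map_neg]
    exact key e _

/-- The twisted generalized Weyl datum attached to a multiquiver. -/
noncomputable def datum : TGWDatum K (MvPolynomial E K) V where
  σ := Γ.sigma K
  t := Γ.tElem K
  σ_comm i j r := by
    have h : ((Γ.sigma K i : MvPolynomial E K →ₐ[K] MvPolynomial E K).comp
        (Γ.sigma K j : MvPolynomial E K →ₐ[K] MvPolynomial E K)) =
        ((Γ.sigma K j : MvPolynomial E K →ₐ[K] MvPolynomial E K).comp
        (Γ.sigma K i : MvPolynomial E K →ₐ[K] MvPolynomial E K)) := by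
      ext e
      simp [sigma]
      ring
    exact DFunLike.congr_fun h r
  t_ne_zero := Γ.tElem_ne_zero K
  t_central i r := mul_comm _ _

/-- The algebra of a multiquiver: the twisted generalized Weyl algebra of its datum, with all
`μ i j = 1`. -/
abbrev Alg := (Γ.datum K).TGWAlgebra (fun _ _ => 1)

/-- The generator `X_v` of the algebra of a multiquiver. -/
noncomputable def X (v : V) : Γ.Alg K := (Γ.datum K).X (fun _ _ => 1) v

/-- The generator `Y_v` of the algebra of a multiquiver. -/
noncomputable def Y (v : V) : Γ.Alg K := (Γ.datum K).Y (fun _ _ => 1) v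

/-- The homogeneous components of the algebra of a multiquiver. -/
noncomputable def algDeg (d : V →₀ ℤ) : Submodule K (Γ.Alg K) :=
  (Γ.datum K).deg (fun _ _ => 1) d

end Multiquiver

section Adjoint

attribute [local instance] LieRing.ofAssociativeRing

variable {K L : Type*} [Field K] [LieRing L] [LieAlgebra K L]

/-- For a derivation `δ` of a Lie algebra, the algebra homomorphism `a ↦ a + ε (δ a)` from the
enveloping algebra to its dual numbers. -/
noncomputable def envelopingDerivAux (δ : LieDerivation K L L) :
    UniversalEnvelopingAlgebra K L →ₐ[K]
      TrivSqZeroExt (UniversalEnvelopingAlgebra K L) (UniversalEnvelopingAlgebra K L) :=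
  UniversalEnvelopingAlgebra.lift K
    { toFun := fun x => TrivSqZeroExt.inl (UniversalEnvelopingAlgebra.ι K x) +
        TrivSqZeroExt.inr (UniversalEnvelopingAlgebra.ι K (δ x))
      map_add' := by intro x y; ext <;> simp
      map_smul' := by intro c x; ext <;> simp
      map_lie' := by
        intro x y
        ext
        · simp only [TrivSqZeroExt.fst_add, TrivSqZeroExt.fst_inl, TrivSqZeroExt.fst_inr,
            add_zero, LieRing.of_associative_ring_bracket, TrivSqZeroExt.fst_sub,
            TrivSqZeroExt.fst_mul, LieHom.map_lie]
        · simp only [TrivSqZeroExt.snd_add, TrivSqZeroExt.snd_inl, TrivSqZeroExt.snd_inr,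
            TrivSqZeroExt.fst_add, TrivSqZeroExt.fst_inl, TrivSqZeroExt.fst_inr,
            zero_add, add_zero, LieRing.of_associative_ring_bracket, TrivSqZeroExt.snd_sub,
            TrivSqZeroExt.snd_mul, LieHom.map_lie, LieDerivation.apply_lie_eq_sub, map_sub,
            smul_eq_mul, MulOpposite.smul_eq_mul_unop, MulOpposite.unop_op]
          abel }

/-- The derivation of the enveloping algebra that extends the derivation `δ` of the Lie algebra. -/
noncomputable def envelopingDeriv (δ : LieDerivation K L L) :
    UniversalEnvelopingAlgebra K L →ₗ[K] UniversalEnvelopingAlgebra K L where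
  toFun a := (envelopingDerivAux δ a).snd
  map_add' a b := by rw [map_add, TrivSqZeroExt.snd_add]
  map_smul' c a := by rw [map_smul, TrivSqZeroExt.snd_smul, RingHom.id_apply]

lemma envelopingDerivAux_ι (δ : LieDerivation K L L) (x : L) :
    envelopingDerivAux δ (UniversalEnvelopingAlgebra.ι K x) =
      TrivSqZeroExt.inl (UniversalEnvelopingAlgebra.ι K x) +
        TrivSqZeroExt.inr (UniversalEnvelopingAlgebra.ι K (δ x)) := by
  rw [envelopingDerivAux, UniversalEnvelopingAlgebra.lift_ι_apply]
  rfl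

lemma envelopingDeriv_ι (δ : LieDerivation K L L) (x : L) :
    envelopingDeriv δ (UniversalEnvelopingAlgebra.ι K x) =
      UniversalEnvelopingAlgebra.ι K (δ x) := by
  change (envelopingDerivAux δ (UniversalEnvelopingAlgebra.ι K x)).snd = _
  rw [envelopingDerivAux_ι, TrivSqZeroExt.snd_add, TrivSqZeroExt.snd_inl, TrivSqZeroExt.snd_inr,
    zero_add]

lemma envelopingDerivAux_fst (δ : LieDerivation K L L) (a : UniversalEnvelopingAlgebra K L) :
    (envelopingDerivAux δ a).fst = a := by
  have h : (TrivSqZeroExt.fstHom K (UniversalEnvelopingAlgebra K L)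
      (UniversalEnvelopingAlgebra K L)).comp (envelopingDerivAux δ) = AlgHom.id K _ := by
    apply UniversalEnvelopingAlgebra.hom_ext
    ext x
    change (envelopingDerivAux δ (UniversalEnvelopingAlgebra.ι K x)).fst = _
    rw [envelopingDerivAux_ι, TrivSqZeroExt.fst_add, TrivSqZeroExt.fst_inl,
      TrivSqZeroExt.fst_inr, add_zero]
    rfl
  exact DFunLike.congr_fun h a

lemma envelopingDeriv_mul (δ : LieDerivation K L L) (a b : UniversalEnvelopingAlgebra K L) :
    envelopingDeriv δ (a * b) = a * envelopingDeriv δ b + envelopingDeriv δ a * b := by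
  change (envelopingDerivAux δ (a * b)).snd =
    a * (envelopingDerivAux δ b).snd + (envelopingDerivAux δ a).snd * b
  rw [map_mul, TrivSqZeroExt.snd_mul, envelopingDerivAux_fst, envelopingDerivAux_fst,
    smul_eq_mul, MulOpposite.smul_eq_mul_unop, MulOpposite.unop_op]

/-- The restriction of `ad x` to a Lie subalgebra that it preserves. -/
def adRestrict (N : LieSubalgebra K L) (x : L) (h : ∀ y ∈ N, ⁅x, y⁆ ∈ N) :
    LieDerivation K N N where
  toFun y := ⟨⁅x, (y : L)⁆, h y y.2⟩
  map_add' y z := Subtype.ext (lie_add x (y : L) (z : L))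
  map_smul' c y := Subtype.ext (lie_smul c x (y : L))
  leibniz' y z := Subtype.ext (by
    change ⁅x, ⁅(y : L), (z : L)⁆⁆ = ⁅(y : L), ⁅x, (z : L)⁆⁆ - ⁅(z : L), ⁅x, (y : L)⁆⁆
    rw [leibniz_lie, ← lie_skew (z : L) ⁅x, (y : L)⁆]
    abel)

lemma lie_mem_lieSpan_of_eigen (x : L) (s : Set L) (hs : ∀ y ∈ s, ∃ c : K, ⁅x, y⁆ = c • y) :
    ∀ y ∈ LieSubalgebra.lieSpan K L s, ⁅x, y⁆ ∈ LieSubalgebra.lieSpan K L s := by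
  intro y hy
  induction hy using LieSubalgebra.lieSpan_induction with
  | mem y h =>
    obtain ⟨c, hc⟩ := hs y h
    rw [hc]
    exact SMulMemClass.smul_mem c (LieSubalgebra.subset_lieSpan h)
  | zero => rw [lie_zero]; exact zero_mem _
  | add y z _ _ hy hz => rw [lie_add]; exact add_mem hy hz
  | smul c y _ hy => rw [lie_smul]; exact SMulMemClass.smul_mem c hy
  | lie y z h1 h2 hy hz =>
    rw [leibniz_lie]
    exact add_mem (LieSubalgebra.lie_mem _ hy h2) (LieSubalgebra.lie_mem _ h1 hz)

end Adjoint

/-! ### Kac–Moody algebras -/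

/-- A realization of an integer matrix `A` over `K`: a vector space `𝔥` with linearly independent
simple coroots in `𝔥` and linearly independent simple roots in its dual, paired by `A`. (No
minimality of the dimension of `𝔥` is imposed, so minimal realizations are included.) -/
structure Realization (K : Type*) [Field K] {V : Type*} (A : V → V → ℤ) (𝔥 : Type*)
    [AddCommGroup 𝔥] [Module K 𝔥] where
  coroot : V → 𝔥
  root : V → Module.Dual K 𝔥
  coroot_indep : LinearIndependent K coroot
  root_indep : LinearIndependent K root
  pairing : ∀ i j, root j (coroot i) = (A i j : K)

namespace Realization

/-- Generators of the Kac–Moody algebra: the elements of `𝔥` and the Chevalley generators. -/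
inductive Gen (V 𝔥 : Type*)
  | h (x : 𝔥) : Gen V 𝔥
  | e (i : V) : Gen V 𝔥
  | f (i : V) : Gen V 𝔥

variable {K : Type*} [Field K] {V : Type*} {A : V → V → ℤ} {𝔥 : Type*} [AddCommGroup 𝔥]
  [Module K 𝔥]

/-- A generator inside the free Lie algebra. -/
noncomputable def Gen.free (K : Type*) [Field K] {V 𝔥 : Type*} (g : Gen V 𝔥) :
    FreeLieAlgebra K (Gen V 𝔥) :=
  FreeLieAlgebra.of K g

variable (K V) in
/-- An element of `𝔥` inside the free Lie algebra. -/
noncomputable abbrev hF (x : 𝔥) : FreeLieAlgebra K (Gen V 𝔥) := Gen.free K (.h x)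

variable (K 𝔥) in
/-- The generator `e i` inside the free Lie algebra. -/
noncomputable abbrev eF (i : V) : FreeLieAlgebra K (Gen V 𝔥) := Gen.free K (.e i)

variable (K 𝔥) in
/-- The generator `f i` inside the free Lie algebra. -/
noncomputable abbrev fF (i : V) : FreeLieAlgebra K (Gen V 𝔥) := Gen.free K (.f i)

/-- The Chevalley–Serre relators of the Kac–Moody algebra. -/
inductive Relator (ρ : Realization K A 𝔥) : FreeLieAlgebra K (Gen V 𝔥) → Prop
  | h_add (x y : 𝔥) : Relator ρ (hF K V (x + y) - (hF K V x + hF K V y))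
  | h_smul (c : K) (x : 𝔥) : Relator ρ (hF K V (c • x) - c • hF K V x)
  | h_h (x y : 𝔥) : Relator ρ ⁅hF K V x, hF K V y⁆
  | e_f (i : V) : Relator ρ (⁅eF K 𝔥 i, fF K 𝔥 i⁆ - hF K V (ρ.coroot i))
  | e_f_ne (i j : V) (hij : i ≠ j) : Relator ρ ⁅eF K 𝔥 i, fF K 𝔥 j⁆
  | h_e (x : 𝔥) (i : V) : Relator ρ (⁅hF K V x, eF K 𝔥 i⁆ - ρ.root i x • eF K 𝔥 i)
  | h_f (x : 𝔥) (i : V) : Relator ρ (⁅hF K V x, fF K 𝔥 i⁆ - (-ρ.root i x) • fF K 𝔥 i)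
  | serre_e (i j : V) (hij : i ≠ j) : Relator ρ
      (((LieAlgebra.ad K (FreeLieAlgebra K (Gen V 𝔥)) (eF K 𝔥 i)) ^ (1 - A i j).toNat) (eF K 𝔥 j))
  | serre_f (i j : V) (hij : i ≠ j) : Relator ρ
      (((LieAlgebra.ad K (FreeLieAlgebra K (Gen V 𝔥)) (fF K 𝔥 i)) ^ (1 - A i j).toNat) (fF K 𝔥 j))

/-- The ideal generated by the Chevalley–Serre relators. -/
noncomputable def ideal (ρ : Realization K A 𝔥) : LieIdeal K (FreeLieAlgebra K (Gen V 𝔥)) :=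
  LieSubmodule.lieSpan K (FreeLieAlgebra K (Gen V 𝔥)) {x | ρ.Relator x}

/-- The Kac–Moody algebra of the realization. -/
abbrev KacMoody (ρ : Realization K A 𝔥) := FreeLieAlgebra K (Gen V 𝔥) ⧸ ρ.ideal

/-- The image of a generator in the Kac–Moody algebra. -/
noncomputable def gen (ρ : Realization K A 𝔥) (g : Gen V 𝔥) : ρ.KacMoody :=
  LieSubmodule.Quotient.mk (Gen.free K g)

lemma gen_eq_of_relator (ρ : Realization K A 𝔥) {x y : FreeLieAlgebra K (Gen V 𝔥)}
    (h : ρ.Relator (x - y)) :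
    (LieSubmodule.Quotient.mk x : ρ.KacMoody) = LieSubmodule.Quotient.mk y :=
  (Submodule.Quotient.eq _).2 (LieSubmodule.subset_lieSpan h)

lemma h_lie_e (ρ : Realization K A 𝔥) (x : 𝔥) (i : V) :
    ⁅ρ.gen (.h x), ρ.gen (.e i)⁆ = ρ.root i x • ρ.gen (.e i) :=
  ρ.gen_eq_of_relator (.h_e x i)

lemma h_lie_f (ρ : Realization K A 𝔥) (x : 𝔥) (i : V) :
    ⁅ρ.gen (.h x), ρ.gen (.f i)⁆ = (-ρ.root i x) • ρ.gen (.f i) :=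
  ρ.gen_eq_of_relator (.h_f x i)

/-- The positive subalgebra, generated by the `e i`. -/
noncomputable def nPos (ρ : Realization K A 𝔥) : LieSubalgebra K ρ.KacMoody :=
  LieSubalgebra.lieSpan K ρ.KacMoody (Set.range fun i => ρ.gen (.e i))

/-- The negative subalgebra, generated by the `f i`. -/
noncomputable def nNeg (ρ : Realization K A 𝔥) : LieSubalgebra K ρ.KacMoody :=
  LieSubalgebra.lieSpan K ρ.KacMoody (Set.range fun i => ρ.gen (.f i))

/-- The generator `e i` as an element of the positive subalgebra. -/
noncomputable def e (ρ : Realization K A 𝔥) (i : V) : ρ.nPos :=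
  ⟨ρ.gen (.e i), LieSubalgebra.subset_lieSpan ⟨i, rfl⟩⟩

/-- The generator `f i` as an element of the negative subalgebra. -/
noncomputable def f (ρ : Realization K A 𝔥) (i : V) : ρ.nNeg :=
  ⟨ρ.gen (.f i), LieSubalgebra.subset_lieSpan ⟨i, rfl⟩⟩

/-- The adjoint action of an element of `𝔥` on the positive subalgebra. -/
noncomputable def adPos (ρ : Realization K A 𝔥) (x : 𝔥) : LieDerivation K ρ.nPos ρ.nPos :=
  adRestrict ρ.nPos (ρ.gen (.h x)) (lie_mem_lieSpan_of_eigen _ _ (by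
    rintro _ ⟨i, rfl⟩
    exact ⟨_, ρ.h_lie_e x i⟩))

/-- The adjoint action of an element of `𝔥` on the negative subalgebra. -/
noncomputable def adNeg (ρ : Realization K A 𝔥) (x : 𝔥) : LieDerivation K ρ.nNeg ρ.nNeg :=
  adRestrict ρ.nNeg (ρ.gen (.h x)) (lie_mem_lieSpan_of_eigen _ _ (by
    rintro _ ⟨i, rfl⟩
    exact ⟨_, ρ.h_lie_f x i⟩))

/-- The enveloping algebra of the positive subalgebra. -/
abbrev UPos (ρ : Realization K A 𝔥) := UniversalEnvelopingAlgebra K ρ.nPos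

/-- The enveloping algebra of the negative subalgebra. -/
abbrev UNeg (ρ : Realization K A 𝔥) := UniversalEnvelopingAlgebra K ρ.nNeg

/-- The generator `e i` in the enveloping algebra. -/
noncomputable def eU (ρ : Realization K A 𝔥) (i : V) : ρ.UPos :=
  UniversalEnvelopingAlgebra.ι K (ρ.e i)

/-- The generator `f i` in the enveloping algebra. -/
noncomputable def fU (ρ : Realization K A 𝔥) (i : V) : ρ.UNeg :=
  UniversalEnvelopingAlgebra.ι K (ρ.f i)

/-- The weight `∑ d i • α i` of an element `d` of the root lattice. -/
noncomputable def weight (ρ : Realization K A 𝔥) (d : V →₀ ℤ) : Module.Dual K 𝔥 :=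
  d.sum fun i n => n • ρ.root i

/-- The weight space of `U(n⁺)` of weight `∑ d i • α i` for the adjoint action of `𝔥`. -/
noncomputable def posWeightSpace (ρ : Realization K A 𝔥) (d : V →₀ ℤ) : Submodule K ρ.UPos :=
  ⨅ x : 𝔥, LinearMap.ker (envelopingDeriv (ρ.adPos x) - ρ.weight d x • LinearMap.id)

/-- The weight space of `U(n⁻)` of weight `∑ d i • α i` for the adjoint action of `𝔥`. -/
noncomputable def negWeightSpace (ρ : Realization K A 𝔥) (d : V →₀ ℤ) : Submodule K ρ.UNeg :=
  ⨅ x : 𝔥, LinearMap.ker (envelopingDeriv (ρ.adNeg x) - ρ.weight d x • LinearMap.id)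

end Realization

/-!
If each `t v` is written as a product of two coefficients, one for `X v` and one for `Y v`, then the
construction acts on polynomials, with `X v` as `r ↦ p v * σ v r`. The generators act injectively
and the base ring acts faithfully, so the radical acts by zero and the span of the words in the
`X v` of a given degree acts faithfully. For fixed `i` the linear factors can be distributed so that
`p i = 1`. Then `(ad X i) ^ n (X j)` acts as `((σ i - 1) ^ n (p j)) * σ i ^ n σ j`, and `p j` is,
up to a factor fixed by `σ i`, a product of `-a i j` linear factors that `σ i` shifts by nonzero
constants. Hence it is killed by the power `1 - a i j` of `σ i - 1`, which is the Serre relation,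
and its translates `σ i ^ m (p j)` with `0 ≤ m ≤ k ≤ -a i j` are linearly independent, and with them
the words `X i ^ m * X j * X i ^ (k - m)`. The weight space for `k α i + α j` is spanned by the
corresponding words in the `e i`, which gives injectivity there. Reversing all edges exchanges the
`X v` and the `Y v`.

That elements satisfying the Serre relations extend to a homomorphism from `U(n⁺)` is not immediate,
since `n⁺` is defined inside the Kac–Moody algebra and not by generators and relations. The lowest
weight Verma module of lowest weight zero is the free algebra on the `e i`. The ideal generated by
the Serre elements is a submodule, and the Kac–Moody algebra acts on the quotient, which is the
algebra presented by the Serre relations; there `e i` acts by left multiplication. Applying elements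
of `n⁺` to the cyclic vector gives the homomorphism.
-/

/-! ### Words -/

section Words

variable {V : Type*}

/-- The multidegree of a word in the free abelian group on the letters. -/
noncomputable def wordDegree (w : List V) : V →₀ ℤ :=
  (w.map fun i => Finsupp.single i 1).sum

@[simp]
lemma wordDegree_nil : wordDegree ([] : List V) = 0 := rfl

@[simp]
lemma wordDegree_cons (i : V) (w : List V) :
    wordDegree (i :: w) = Finsupp.single i 1 + wordDegree w := by
  simp [wordDegree]

@[simp]
lemma wordDegree_append (w w' : List V) :
    wordDegree (w ++ w') = wordDegree w + wordDegree w' := by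
  simp [wordDegree]

@[simp]
lemma wordDegree_replicate (k : ℕ) (i : V) :
    wordDegree (List.replicate k i) = Finsupp.single i (k : ℤ) := by
  simp [wordDegree]

lemma wordDegree_apply [DecidableEq V] (w : List V) (i : V) : wordDegree w i = w.count i := by
  induction w with
  | nil => simp
  | cons j w ih =>
    rw [wordDegree_cons, Finsupp.add_apply, ih, List.count_cons, Finsupp.single_apply]
    split_ifs <;> simp_all [add_comm]

lemma wordDegree_eq_iff_perm {w w' : List V} : wordDegree w = wordDegree w' ↔ w.Perm w' := by
  classical
  rw [List.perm_iff_count, DFunLike.ext_iff]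
  simp only [wordDegree_apply, Nat.cast_inj]

lemma exists_eq_replicate_append_of_wordDegree_eq {w : List V} {i j : V} {k : ℕ}
    (hw : wordDegree w = Finsupp.single i (k : ℤ) + Finsupp.single j 1) :
    ∃ m ≤ k, w = List.replicate m i ++ j :: List.replicate (k - m) i := by
  have hperm : w.Perm (j :: List.replicate k i) :=
    wordDegree_eq_iff_perm.1 (by simp [hw, add_comm])
  obtain ⟨x, y, rfl⟩ := List.append_of_mem (hperm.mem_iff.2 List.mem_cons_self)
  have hxy : x ++ y = List.replicate k i :=
    List.perm_replicate.1 ((List.perm_middle.symm.trans hperm).cons_inv)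
  obtain ⟨hlen, hx, hy⟩ := List.append_eq_replicate_iff.1 hxy
  refine ⟨x.length, by omega, ?_⟩
  rw [← hx, (by omega : k - x.length = y.length), ← hy]

end Words

section WordSpan

variable (K : Type*) {V B C : Type*} [CommSemiring K] [Semiring B] [Algebra K B]
  [Semiring C] [Algebra K C]

/-- The span of the products of the family `a` along the words of multidegree `d`. -/
noncomputable def wordSpan (a : V → B) (d : V →₀ ℤ) : Submodule K B :=
  Submodule.span K ((fun w : List V => (w.map a).prod) '' {w | wordDegree w = d})

lemma prod_mem_wordSpan (a : V → B) (w : List V) :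
    (w.map a).prod ∈ wordSpan K a (wordDegree w) :=
  Submodule.subset_span ⟨w, rfl, rfl⟩

lemma map_wordSpan (ψ : B →ₐ[K] C) (a : V → B) (d : V →₀ ℤ) :
    (wordSpan K a d).map ψ.toLinearMap = wordSpan K (ψ ∘ a) d := by
  simp [wordSpan, Submodule.map_span, Set.image_image, map_list_prod]

lemma map_mem_wordSpan (ψ : B →ₐ[K] C) {a : V → B} {d : V →₀ ℤ} {x : B} (hx : x ∈ wordSpan K a d) :
    ψ x ∈ wordSpan K (fun i => ψ (a i)) d :=
  (map_wordSpan K ψ a d).le (Submodule.mem_map_of_mem hx)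

lemma span_range_prod_eq_top {a : V → B} (ha : Algebra.adjoin K (Set.range a) = ⊤) :
    Submodule.span K (Set.range fun w : List V => (w.map a).prod) = ⊤ := by
  rw [eq_top_iff, ← Algebra.top_toSubmodule, ← ha, Algebra.adjoin_eq_span]
  refine Submodule.span_mono fun x hx => ?_
  obtain ⟨l, hl, rfl⟩ := Submonoid.exists_list_of_mem_closure hx
  obtain ⟨w, rfl⟩ : l ∈ Set.range (List.map a) := by rwa [Set.range_list_map]
  exact ⟨w, rfl⟩

lemma iSup_wordSpan_eq_top {a : V → B} (ha : Algebra.adjoin K (Set.range a) = ⊤) :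
    ⨆ d, wordSpan K a d = ⊤ := by
  rw [eq_top_iff, ← span_range_prod_eq_top K ha, Submodule.span_le]
  rintro _ ⟨w, rfl⟩
  exact Submodule.mem_iSup_of_mem _ (prod_mem_wordSpan K a w)

lemma mul_mem_wordSpan {a : V → B} {c d : V →₀ ℤ} {x y : B} (hx : x ∈ wordSpan K a c)
    (hy : y ∈ wordSpan K a d) : x * y ∈ wordSpan K a (c + d) := by
  have hxy := Submodule.mul_mem_mul hx hy
  rw [wordSpan, wordSpan, Submodule.span_mul_span] at hxy
  refine Submodule.span_mono ?_ hxy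
  rintro _ ⟨_, ⟨w, rfl, rfl⟩, _, ⟨w', rfl, rfl⟩, rfl⟩
  exact ⟨w ++ w', by simp, by simp⟩

lemma wordSpan_single_add_single_le (a : V → B) (i j : V) (k : ℕ) :
    wordSpan K a (Finsupp.single i (k : ℤ) + Finsupp.single j 1) ≤
      Submodule.span K (Set.range fun m : Fin (k + 1) => a i ^ (m : ℕ) * a j * a i ^ (k - m)) := by
  refine Submodule.span_mono ?_
  rintro _ ⟨w, hw, rfl⟩
  obtain ⟨m, hm, rfl⟩ := exists_eq_replicate_append_of_wordDegree_eq hw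
  exact ⟨⟨m, Nat.lt_succ_of_le hm⟩, by simp [mul_assoc]⟩

end WordSpan

lemma injOn_wordSpan {K V B C : Type*} [Field K] [Ring B] [Algebra K B] [Ring C] [Algebra K C]
    (ψ : B →ₐ[K] C) (a : V → B) (i j : V) (k : ℕ)
    (h : LinearIndependent K fun m : Fin (k + 1) =>
      ψ (a i) ^ (m : ℕ) * ψ (a j) * ψ (a i) ^ (k - m)) :
    Set.InjOn ψ (wordSpan K a (Finsupp.single i (k : ℤ) + Finsupp.single j 1)) := by
  refine Set.InjOn.mono (wordSpan_single_add_single_le K a i j k) ?_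
  refine (LinearMap.disjoint_ker_iff_injOn (f := ψ.toLinearMap)).1
    (Submodule.range_ker_disjoint ?_)
  simpa [Function.comp_def] using h

/-! ### Normal forms in the twisted generalized Weyl construction -/

namespace TGWDatum

section Construction

variable {K R I : Type*} [Field K] [Ring R] [Algebra K R] (D : TGWDatum K R I) (μ : I → I → Kˣ)

/-- The structural homomorphism from the base ring to the twisted generalized Weyl construction. -/
noncomputable def coeffHom : R →ₐ[K] D.Construction μ :=
  AlgHom.ofLinearMap
    { toFun := fun r => D.cgen μ (.coeff r)
      map_add' := fun r s =>
        (RingQuot.mkAlgHom_rel K (Rel.coeff_add r s)).trans (map_add _ _ _)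
      map_smul' := fun c r => by
        rw [Algebra.smul_def, RingHom.id_apply, Algebra.smul_def]
        refine (RingQuot.mkAlgHom_rel K (Rel.coeff_mul _ r)).trans ?_
        rw [map_mul, RingQuot.mkAlgHom_rel K (Rel.coeff_scalar c), AlgHom.commutes]
        rfl }
    (by
      have h := RingQuot.mkAlgHom_rel K (Rel.coeff_scalar (D := D) (μ := μ) 1)
      rwa [map_one, map_one, map_one] at h)
    fun r s => (RingQuot.mkAlgHom_rel K (Rel.coeff_mul r s)).trans (map_mul _ _ _)

lemma cgen_coeff (r : R) : D.cgen μ (.coeff r) = D.coeffHom μ r := rfl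

lemma cgen_X_mul_coeffHom (i : I) (r : R) :
    D.cgen μ (.X i) * D.coeffHom μ r = D.coeffHom μ (D.σ i r) * D.cgen μ (.X i) := by
  have h := RingQuot.mkAlgHom_rel K (Rel.X_coeff (D := D) (μ := μ) i r)
  rwa [map_mul, map_mul] at h

lemma cgen_Y_mul_coeffHom (i : I) (r : R) :
    D.cgen μ (.Y i) * D.coeffHom μ r = D.coeffHom μ ((D.σ i).symm r) * D.cgen μ (.Y i) := by
  have h := RingQuot.mkAlgHom_rel K (Rel.Y_coeff (D := D) (μ := μ) i r)
  rwa [map_mul, map_mul] at h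

lemma cgen_Y_mul_cgen_X (i : I) :
    D.cgen μ (.Y i) * D.cgen μ (.X i) = D.coeffHom μ (D.t i) := by
  have h := RingQuot.mkAlgHom_rel K (Rel.Y_X (D := D) (μ := μ) i)
  rwa [map_mul] at h

lemma cgen_X_mul_cgen_Y (i : I) :
    D.cgen μ (.X i) * D.cgen μ (.Y i) = D.coeffHom μ (D.σ i (D.t i)) := by
  have h := RingQuot.mkAlgHom_rel K (Rel.X_Y (D := D) (μ := μ) i)
  rwa [map_mul] at h

lemma cgen_X_mul_cgen_Y_of_ne {i j : I} (hij : i ≠ j) :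
    D.cgen μ (.X i) * D.cgen μ (.Y j) = (μ i j : K) • (D.cgen μ (.Y j) * D.cgen μ (.X i)) := by
  have h := RingQuot.mkAlgHom_rel K (Rel.X_Y_ne (D := D) (μ := μ) i j hij)
  rwa [map_smul, map_mul, map_mul] at h

lemma cgen_Y_mul_cgen_X_of_ne {i j : I} (hij : i ≠ j) :
    D.cgen μ (.Y i) * D.cgen μ (.X j) =
      ((μ j i)⁻¹ : Kˣ).val • (D.cgen μ (.X j) * D.cgen μ (.Y i)) := by
  rw [cgen_X_mul_cgen_Y_of_ne D μ hij.symm, smul_smul, Units.inv_mul, one_smul]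

lemma adjoin_range_cgen : Algebra.adjoin K (Set.range (D.cgen μ)) = ⊤ := by
  have hrange : Set.range (D.cgen μ) =
      RingQuot.mkAlgHom K (D.Rel μ) '' Set.range (FreeAlgebra.ι K) := by
    rw [← Set.range_comp]
    rfl
  rw [hrange, ← AlgHom.map_adjoin, FreeAlgebra.adjoin_range_ι, Algebra.map_top,
    (AlgHom.range_eq_top _).2 (RingQuot.mkAlgHom_surjective K _)]

lemma prod_mem_cdeg (l : List (Gen R I)) :
    (l.map (D.cgen μ)).prod ∈ D.cdeg μ (l.map Gen.deg).sum :=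
  Submodule.subset_span ⟨l, rfl, rfl⟩

lemma one_mem_cdeg : (1 : D.Construction μ) ∈ D.cdeg μ 0 := D.prod_mem_cdeg μ []

lemma cgen_pow_mem_cdeg (g : Gen R I) (n : ℕ) : D.cgen μ g ^ n ∈ D.cdeg μ (n • g.deg) := by
  simpa using D.prod_mem_cdeg μ (List.replicate n g)

variable {D μ} in
lemma mul_mem_cdeg {x y : D.Construction μ} {c d : I →₀ ℤ} (hx : x ∈ D.cdeg μ c)
    (hy : y ∈ D.cdeg μ d) : x * y ∈ D.cdeg μ (c + d) := by
  have hxy := Submodule.mul_mem_mul hx hy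
  rw [cdeg, cdeg, Submodule.span_mul_span] at hxy
  refine Submodule.span_mono ?_ hxy
  rintro _ ⟨_, ⟨l, rfl, rfl⟩, _, ⟨m, rfl, rfl⟩, rfl⟩
  exact ⟨l ++ m, by simp, by simp⟩

lemma iSup_cdeg_eq_top : ⨆ d, D.cdeg μ d = ⊤ := by
  rw [eq_top_iff, ← span_range_prod_eq_top K (D.adjoin_range_cgen μ), Submodule.span_le]
  rintro _ ⟨l, rfl⟩
  exact Submodule.mem_iSup_of_mem _ (D.prod_mem_cdeg μ l)

/-- The product of the generators `X i` along a word. -/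
noncomputable def xWord (w : List I) : D.Construction μ := (w.map fun i => D.cgen μ (.X i)).prod

/-- The product of the generators `Y i` along a word. -/
noncomputable def yWord (w : List I) : D.Construction μ := (w.map fun i => D.cgen μ (.Y i)).prod

@[simp]
lemma xWord_nil : D.xWord μ [] = 1 := rfl

@[simp]
lemma yWord_nil : D.yWord μ [] = 1 := rfl

@[simp]
lemma xWord_cons (i : I) (w : List I) : D.xWord μ (i :: w) = D.cgen μ (.X i) * D.xWord μ w := by
  simp [xWord]

@[simp]
lemma yWord_cons (i : I) (w : List I) : D.yWord μ (i :: w) = D.cgen μ (.Y i) * D.yWord μ w := by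
  simp [yWord]

lemma yWord_append_singleton (w : List I) (i : I) :
    D.yWord μ (w ++ [i]) = D.yWord μ w * D.cgen μ (.Y i) := by
  simp [yWord]

lemma exists_yWord_mul_coeffHom (w : List I) (r : R) :
    ∃ s, D.yWord μ w * D.coeffHom μ r = D.coeffHom μ s * D.yWord μ w := by
  induction w with
  | nil => exact ⟨r, by simp⟩
  | cons i w ih =>
    obtain ⟨s, hs⟩ := ih
    refine ⟨(D.σ i).symm s, ?_⟩
    rw [yWord_cons, mul_assoc, hs, ← mul_assoc, cgen_Y_mul_coeffHom, mul_assoc]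

lemma exists_cgen_X_mul_yWord_of_mem [DecidableEq I] {i : I} {w : List I} (hi : i ∈ w) :
    ∃ r, D.cgen μ (.X i) * D.yWord μ w = D.coeffHom μ r * D.yWord μ (w.erase i) := by
  induction w with
  | nil => simp at hi
  | cons j w ih =>
    obtain rfl | hij := eq_or_ne i j
    · refine ⟨D.σ i (D.t i), ?_⟩
      rw [yWord_cons, ← mul_assoc, cgen_X_mul_cgen_Y, List.erase_cons_head]
    · obtain ⟨r, hr⟩ := ih (List.mem_of_ne_of_mem hij hi)
      refine ⟨(μ i j : K) • (D.σ j).symm r, ?_⟩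
      rw [yWord_cons, ← mul_assoc, cgen_X_mul_cgen_Y_of_ne _ _ hij, smul_mul_assoc, mul_assoc, hr,
        ← mul_assoc, cgen_Y_mul_coeffHom, List.erase_cons_tail (by simpa using hij.symm),
        yWord_cons, map_smul, smul_mul_assoc, mul_assoc]

lemma exists_cgen_X_mul_yWord_of_notMem {i : I} {w : List I} (hi : i ∉ w) :
    ∃ r, D.cgen μ (.X i) * D.yWord μ w = D.coeffHom μ r * D.yWord μ w * D.cgen μ (.X i) := by
  induction w with
  | nil => exact ⟨1, by simp⟩
  | cons j w ih =>
    obtain ⟨hij, hi⟩ : i ≠ j ∧ i ∉ w := by simpa using hi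
    obtain ⟨r, hr⟩ := ih hi
    refine ⟨(μ i j : K) • (D.σ j).symm r, ?_⟩
    rw [yWord_cons, ← mul_assoc, cgen_X_mul_cgen_Y_of_ne _ _ hij, smul_mul_assoc, mul_assoc, hr,
      ← mul_assoc, ← mul_assoc, cgen_Y_mul_coeffHom, map_smul, smul_mul_assoc, smul_mul_assoc,
      mul_assoc (D.coeffHom μ _)]

lemma exists_cgen_Y_mul_xWord_of_mem [DecidableEq I] {i : I} {w : List I} (hi : i ∈ w) :
    ∃ r, D.cgen μ (.Y i) * D.xWord μ w = D.coeffHom μ r * D.xWord μ (w.erase i) := by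
  induction w with
  | nil => simp at hi
  | cons j w ih =>
    obtain rfl | hij := eq_or_ne i j
    · refine ⟨D.t i, ?_⟩
      rw [xWord_cons, ← mul_assoc, cgen_Y_mul_cgen_X, List.erase_cons_head]
    · obtain ⟨r, hr⟩ := ih (List.mem_of_ne_of_mem hij hi)
      refine ⟨((μ j i)⁻¹ : Kˣ).val • D.σ j r, ?_⟩
      rw [xWord_cons, ← mul_assoc, cgen_Y_mul_cgen_X_of_ne _ _ hij, smul_mul_assoc, mul_assoc, hr,
        ← mul_assoc, cgen_X_mul_coeffHom, List.erase_cons_tail (by simpa using hij.symm),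
        xWord_cons, map_smul, smul_mul_assoc, mul_assoc]

lemma exists_yWord_mul_xWord_of_perm {y x : List I} (hyx : y.Perm x) :
    ∃ r, D.yWord μ y * D.xWord μ x = D.coeffHom μ r := by
  classical
  induction y using List.reverseRecOn generalizing x with
  | nil =>
    obtain rfl := List.nil_perm.1 hyx
    exact ⟨1, by simp⟩
  | append_singleton y i ih =>
    have hi : i ∈ x := hyx.subset (by simp)
    have hy : y.Perm (x.erase i) :=
      (List.perm_append_singleton i y |>.symm.trans hyx |>.trans
        (List.perm_cons_erase hi)).cons_inv
    obtain ⟨r, hr⟩ := D.exists_cgen_Y_mul_xWord_of_mem μ hi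
    obtain ⟨s, hs⟩ := D.exists_yWord_mul_coeffHom μ y r
    obtain ⟨q, hq⟩ := ih hy
    refine ⟨s * q, ?_⟩
    rw [yWord_append_singleton, mul_assoc, hr, ← mul_assoc, hs, mul_assoc, hq, map_mul]

lemma exists_normal_form (l : List (Gen R I)) : ∃ (r : R) (y x : List I),
    (l.map (D.cgen μ)).prod = D.coeffHom μ r * D.yWord μ y * D.xWord μ x ∧
      (l.map Gen.deg).sum + wordDegree y = wordDegree x := by
  classical
  induction l with
  | nil => exact ⟨1, [], [], by simp, by simp⟩
  | cons g l ih =>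
    obtain ⟨r, y, x, hprod, hdeg⟩ := ih
    simp only [List.map_cons, List.prod_cons, hprod, List.sum_cons, add_assoc]
    cases g with
    | coeff s => exact ⟨s * r, y, x, by simp [cgen_coeff, mul_assoc], by simpa [Gen.deg] using hdeg⟩
    | Y i =>
      refine ⟨(D.σ i).symm r, i :: y, x, ?_, ?_⟩
      · simp only [yWord_cons, ← mul_assoc, cgen_Y_mul_coeffHom]
      · simp [Gen.deg, ← hdeg, add_left_comm]
    | X i =>
      rw [← mul_assoc, ← mul_assoc, cgen_X_mul_coeffHom, mul_assoc (D.coeffHom μ _)]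
      by_cases hi : i ∈ y
      · obtain ⟨s, hs⟩ := D.exists_cgen_X_mul_yWord_of_mem μ hi
        refine ⟨D.σ i r * s, y.erase i, x, by rw [hs, map_mul]; simp only [mul_assoc], ?_⟩
        have hy := wordDegree_eq_iff_perm.2 (List.perm_cons_erase hi)
        rw [wordDegree_cons] at hy
        rw [← hdeg, hy, Gen.deg, add_left_comm]
      · obtain ⟨s, hs⟩ := D.exists_cgen_X_mul_yWord_of_notMem μ hi
        refine ⟨D.σ i r * s, y, i :: x, ?_, by rw [hdeg, wordDegree_cons, Gen.deg]⟩
        rw [hs, map_mul, xWord_cons]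
        simp only [mul_assoc]

lemma cdeg_zero_le_range_coeffHom :
    D.cdeg μ 0 ≤ LinearMap.range (D.coeffHom μ).toLinearMap := by
  refine Submodule.span_le.2 ?_
  rintro _ ⟨l, hl, rfl⟩
  obtain ⟨r, y, x, hprod, hdeg⟩ := D.exists_normal_form μ l
  rw [hl, zero_add] at hdeg
  obtain ⟨s, hs⟩ := D.exists_yWord_mul_xWord_of_perm μ (wordDegree_eq_iff_perm.1 hdeg)
  exact ⟨r * s, by simp [hprod, mul_assoc, hs]⟩

end Construction

end TGWDatum

/-! ### Representations on the base ring -/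

namespace TGWDatum

section Radical

variable {K R I B : Type*} [Field K] [Ring R] [Algebra K R] [Ring B] [Algebra K B]
  {D : TGWDatum K R I} {μ : I → I → Kˣ}

lemma isGraded_span {S : Set (D.Construction μ)} (hS : ∀ s ∈ S, ∃ d, s ∈ D.cdeg μ d) :
    D.IsGraded μ (TwoSidedIdeal.span S) := by
  intro z hz
  rw [TwoSidedIdeal.mem_span_iff_mem_addSubgroup_closure] at hz
  refine (AddSubgroup.closure_le _).2 ?_ hz
  rintro _ ⟨_, ⟨a, -, s, hs, rfl⟩, b, -, rfl⟩
  obtain ⟨d, hd⟩ := hS s hs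
  have ha : a ∈ ⨆ c, D.cdeg μ c := D.iSup_cdeg_eq_top μ ▸ Submodule.mem_top
  have hb : b ∈ ⨆ c, D.cdeg μ c := D.iSup_cdeg_eq_top μ ▸ Submodule.mem_top
  simp only [SetLike.mem_coe]
  induction ha using Submodule.iSup_induction' with
  | zero => simp
  | add a a' _ _ iha iha' => rw [add_mul, add_mul]; exact add_mem iha iha'
  | mem c a ha =>
    induction hb using Submodule.iSup_induction' with
    | zero => simp
    | add b b' _ _ ihb ihb' => rw [mul_add]; exact add_mem ihb ihb'
    | mem e b hb =>
      have hsJ := TwoSidedIdeal.subset_span hs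
      exact AddSubgroup.subset_closure
        ⟨TwoSidedIdeal.mul_mem_right _ _ _ (TwoSidedIdeal.mul_mem_left _ _ _ hsJ),
          _, mul_mem_cdeg (mul_mem_cdeg ha hd) hb⟩

lemma mem_radical_of_map_eq_zero (φ : D.Construction μ →ₐ[K] B)
    (hφ : Function.Injective (φ.comp (D.coeffHom μ))) {x : D.Construction μ} {d : I →₀ ℤ}
    (hxd : x ∈ D.cdeg μ d) (hx : φ x = 0) : x ∈ D.radical μ := by
  have hker : TwoSidedIdeal.span {x} ≤ TwoSidedIdeal.ker φ :=
    TwoSidedIdeal.span_le.2 (Set.singleton_subset_iff.2 ((TwoSidedIdeal.mem_ker φ).2 hx))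
  suffices hJ : TwoSidedIdeal.span {x} ≤ D.radical μ from hJ (TwoSidedIdeal.subset_span rfl)
  refine le_sSup ⟨isGraded_span ?_, fun y hy hy0 => ?_⟩
  · rintro _ rfl
    exact ⟨d, hxd⟩
  · obtain ⟨r, rfl⟩ := D.cdeg_zero_le_range_coeffHom μ hy0
    have hr : r = 0 := (injective_iff_map_eq_zero _).1 hφ r ((TwoSidedIdeal.mem_ker φ).1 (hker hy))
    simp [hr]

lemma exists_mem_cdeg_isLeftRegular (φ : D.Construction μ →ₐ[K] B)
    (hX : ∀ i, IsLeftRegular (φ (D.cgen μ (.X i)))) (hY : ∀ i, IsLeftRegular (φ (D.cgen μ (.Y i))))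
    (d : I →₀ ℤ) : ∃ u ∈ D.cdeg μ d, IsLeftRegular (φ u) := by
  induction d using Finsupp.induction_linear with
  | zero => exact ⟨1, D.one_mem_cdeg μ, by simpa using isRegular_one.left⟩
  | add c d hc hd =>
    obtain ⟨u, huc, hu⟩ := hc
    obtain ⟨v, hvd, hv⟩ := hd
    exact ⟨u * v, mul_mem_cdeg huc hvd, by simpa using hu.mul hv⟩
  | single i n =>
    obtain ⟨n, rfl | rfl⟩ := n.eq_nat_or_neg
    · refine ⟨_, ?_, (map_pow φ (D.cgen μ (.X i)) n).symm ▸ (hX i).pow n⟩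
      simpa [Gen.deg] using D.cgen_pow_mem_cdeg μ (.X i) n
    · refine ⟨_, ?_, (map_pow φ (D.cgen μ (.Y i)) n).symm ▸ (hY i).pow n⟩
      simpa [Gen.deg] using D.cgen_pow_mem_cdeg μ (.Y i) n

lemma radical_le_ker (φ : D.Construction μ →ₐ[K] B)
    (hX : ∀ i, IsLeftRegular (φ (D.cgen μ (.X i))))
    (hY : ∀ i, IsLeftRegular (φ (D.cgen μ (.Y i)))) :
    D.radical μ ≤ TwoSidedIdeal.ker φ := by
  refine sSup_le ?_
  rintro J ⟨hJ, hJ0⟩ x hx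
  suffices hle : AddSubgroup.closure {y | y ∈ J ∧ ∃ d, y ∈ D.cdeg μ d} ≤
      (φ : D.Construction μ →+ B).ker from (TwoSidedIdeal.mem_ker φ).2 (hle (hJ x hx))
  refine (AddSubgroup.closure_le _).2 ?_
  rintro y ⟨hyJ, d, hyd⟩
  obtain ⟨u, hud, hu⟩ := exists_mem_cdeg_isLeftRegular φ hX hY (-d)
  have huy : u * y = 0 :=
    hJ0 _ (J.mul_mem_left _ _ hyJ) (by simpa using mul_mem_cdeg hud hyd)
  exact hu (by simpa using congrArg φ huy)

lemma proj_eq_zero_iff {x : D.Construction μ} : D.proj μ x = 0 ↔ x ∈ D.radical μ := by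
  rw [TwoSidedIdeal.mem_iff, ← map_zero (D.proj μ)]
  exact RingCon.eq _

end Radical

section Algebra

variable {K R I : Type*} [Field K] [Ring R] [Algebra K R] {D : TGWDatum K R I} {μ : I → I → Kˣ}

lemma wordSpan_X_le_deg (d : I →₀ ℤ) : wordSpan K (D.X μ) d ≤ D.deg μ d := by
  have hX : D.X μ = D.proj μ ∘ fun i => D.cgen μ (.X i) := rfl
  rw [hX, ← map_wordSpan]
  refine Submodule.map_mono (Submodule.span_le.2 ?_)
  rintro _ ⟨w, rfl, rfl⟩
  have hdeg : ((w.map (.X : I → Gen R I)).map Gen.deg).sum = wordDegree w := by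
    simp [wordDegree, Function.comp_def, Gen.deg]
  have hmem := D.prod_mem_cdeg μ (w.map .X)
  rwa [hdeg, List.map_map] at hmem

lemma wordSpan_Y_le_deg (d : I →₀ ℤ) : wordSpan K (D.Y μ) d ≤ D.deg μ (-d) := by
  have hY : D.Y μ = D.proj μ ∘ fun i => D.cgen μ (.Y i) := rfl
  rw [hY, ← map_wordSpan]
  refine Submodule.map_mono (Submodule.span_le.2 ?_)
  rintro _ ⟨w, rfl, rfl⟩
  have hdeg : ((w.map (.Y : I → Gen R I)).map Gen.deg).sum = -wordDegree w := by
    simp [wordDegree, Function.comp_def, Gen.deg, List.sum_neg]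
  have hmem := D.prod_mem_cdeg μ (w.map .Y)
  rwa [hdeg, List.map_map] at hmem

end Algebra

/-- Coefficients for which `X i ↦ xCoeff i * σ i`, `Y i ↦ yCoeff i * (σ i)⁻¹` defines an action
of the twisted generalized Weyl construction on its base ring. -/
structure TwistedRep {K R I : Type*} [Field K] [CommRing R] [Algebra K R] (D : TGWDatum K R I)
    (μ : I → I → Kˣ) where
  xCoeff : I → R
  yCoeff : I → R
  Y_X : ∀ i, yCoeff i * (D.σ i).symm (xCoeff i) = D.t i
  X_Y : ∀ i j, i ≠ j →
    xCoeff i * D.σ i (yCoeff j) = (μ i j : K) • (yCoeff j * (D.σ j).symm (xCoeff i))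

/-- The operator `r ↦ a * τ r` on a commutative algebra. -/
noncomputable def twistedMul {K R : Type*} [Field K] [CommRing R] [Algebra K R] (a : R)
    (τ : R →ₗ[K] R) : Module.End K R :=
  LinearMap.mulLeft K a ∘ₗ τ

@[simp]
lemma twistedMul_apply {K R : Type*} [Field K] [CommRing R] [Algebra K R] (a : R)
    (τ : R →ₗ[K] R) (r : R) : twistedMul a τ r = a * τ r := rfl

lemma isLeftRegular_twistedMul {K R : Type*} [Field K] [CommRing R] [IsDomain R] [Algebra K R]
    {a : R} (ha : a ≠ 0) (τ : R ≃ₗ[K] R) : IsLeftRegular (twistedMul a τ.toLinearMap) := by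
  intro φ φ' h
  refine LinearMap.ext fun r => τ.injective (mul_left_cancel₀ ha ?_)
  exact LinearMap.congr_fun h r

namespace TwistedRep

variable {K R I : Type*} [Field K] [CommRing R] [Algebra K R] {D : TGWDatum K R I}
  {μ : I → I → Kˣ} (G : D.TwistedRep μ)

/-- The operators by which the generators act. -/
noncomputable def op : Gen R I → Module.End K R
  | .coeff r => LinearMap.mulLeft K r
  | .X i => twistedMul (G.xCoeff i) (D.σ i).toLinearMap
  | .Y i => twistedMul (G.yCoeff i) (D.σ i).symm.toLinearMap

/-- The representation of the twisted generalized Weyl construction on its base ring. -/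
noncomputable def constructionRep : D.Construction μ →ₐ[K] Module.End K R :=
  RingQuot.liftAlgHom K ⟨FreeAlgebra.lift K G.op, by
    have hcomm : ∀ i j r, (D.σ i) ((D.σ j).symm r) = (D.σ j).symm (D.σ i r) := by
      intro i j r
      apply (D.σ j).injective
      rw [AlgEquiv.apply_symm_apply, ← D.σ_comm, AlgEquiv.apply_symm_apply]
    intro x y h
    ext m
    cases h with
    | coeff_add r s => simp [Gen.free, op, add_mul]
    | coeff_mul r s => simp [Gen.free, op]
    | coeff_scalar c => simp [Gen.free, op, Algebra.smul_def]
    | X_coeff i r => simp [Gen.free, op, mul_left_comm]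
    | Y_coeff i r => simp [Gen.free, op, mul_left_comm]
    | Y_X i => simp [Gen.free, op, ← G.Y_X i]
    | X_Y i => simp [Gen.free, op, ← G.Y_X i, mul_left_comm]
    | X_Y_ne i j hij =>
      simp only [Gen.free, map_mul, map_smul, FreeAlgebra.lift_ι_apply, op, LinearMap.smul_apply,
        Module.End.mul_apply, twistedMul_apply, AlgEquiv.toLinearMap_apply, hcomm]
      rw [← mul_assoc, G.X_Y i j hij, smul_mul_assoc, mul_assoc]⟩

lemma constructionRep_cgen (g : Gen R I) : G.constructionRep (D.cgen μ g) = G.op g := by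
  rw [constructionRep, cgen, RingQuot.liftAlgHom_mkAlgHom_apply, Gen.free,
    FreeAlgebra.lift_ι_apply]

lemma constructionRep_comp_coeffHom_injective :
    Function.Injective (G.constructionRep.comp (D.coeffHom μ)) := by
  intro r s h
  have h1 := LinearMap.congr_fun h 1
  simpa [← cgen_coeff, constructionRep_cgen, op] using h1

lemma proj_eq_zero_of_constructionRep_eq_zero {x : D.Construction μ} {d : I →₀ ℤ}
    (hxd : x ∈ D.cdeg μ d) (hx : G.constructionRep x = 0) : D.proj μ x = 0 :=
  proj_eq_zero_iff.2
    (mem_radical_of_map_eq_zero _ G.constructionRep_comp_coeffHom_injective hxd hx)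

variable [IsDomain R]

lemma radical_le_ker_constructionRep : D.radical μ ≤ TwoSidedIdeal.ker G.constructionRep := by
  refine radical_le_ker _ (fun i => ?_) fun i => ?_ <;> rw [constructionRep_cgen]
  · refine isLeftRegular_twistedMul (fun h => D.t_ne_zero i ?_) (D.σ i).toLinearEquiv
    rw [← G.Y_X, h, map_zero, mul_zero]
  · refine isLeftRegular_twistedMul (fun h => D.t_ne_zero i ?_) (D.σ i).symm.toLinearEquiv
    rw [← G.Y_X, h, zero_mul]

/-- The representation of the twisted generalized Weyl algebra on its base ring. -/
noncomputable def rep : D.TGWAlgebra μ →ₐ[K] Module.End K R :=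
  RingCon.liftₐ _ G.constructionRep
    (TwoSidedIdeal.ringCon_le_iff.1 G.radical_le_ker_constructionRep)

@[simp]
lemma rep_X (i : I) : G.rep (D.X μ i) = twistedMul (G.xCoeff i) (D.σ i).toLinearMap :=
  G.constructionRep_cgen (.X i)

@[simp]
lemma rep_Y (i : I) : G.rep (D.Y μ i) = twistedMul (G.yCoeff i) (D.σ i).symm.toLinearMap :=
  G.constructionRep_cgen (.Y i)

lemma eq_zero_of_mem_deg {x : D.TGWAlgebra μ} {d : I →₀ ℤ} (hxd : x ∈ D.deg μ d)
    (hx : G.rep x = 0) : x = 0 := by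
  obtain ⟨x, hxd, rfl⟩ := hxd
  exact G.proj_eq_zero_of_constructionRep_eq_zero hxd hx

end TwistedRep

end TGWDatum

/-! ### Difference degree and iterated commutators -/

section DifferenceDegree

open Polynomial

/-- The vector `p` has degree exactly `n` with respect to the difference operator `τ - 1`. -/
def HasDiffDegree {K M : Type*} [CommRing K] [AddCommGroup M] [Module K M] (τ : Module.End K M)
    (n : ℕ) (p : M) : Prop :=
  ((τ - 1) ^ n) p ≠ 0 ∧ ((τ - 1) ^ (n + 1)) p = 0

namespace HasDiffDegree

section Module

variable {K M : Type*} [Field K] [AddCommGroup M] [Module K M] {τ : Module.End K M} {n : ℕ} {p : M}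

lemma eq_zero_of_aeval (hp : HasDiffDegree τ n p) {q : K[X]} (hq : q.natDegree ≤ n)
    (h : aeval τ q p = 0) : q = 0 := by
  by_contra hq0
  obtain ⟨r, hr, hdvd⟩ := exists_eq_pow_rootMultiplicity_mul_and_not_dvd q hq0 1
  set m := q.rootMultiplicity 1
  have hmn : m ≤ n := by
    refine le_trans ?_ hq
    simpa only [natDegree_pow, natDegree_X_sub_C, mul_one] using
      natDegree_le_of_dvd (pow_rootMultiplicity_dvd q 1) hq0
  obtain ⟨u, v, huv⟩ : IsCoprime r ((X - C 1) ^ (n + 1)) :=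
    (((prime_X_sub_C 1).coprime_iff_not_dvd.2 hdvd).pow_left).symm
  have hBezout : ((X - C 1) ^ n : K[X]) =
      (X - C 1) ^ (n - m) * u * q + (X - C 1) ^ n * v * (X - C 1) ^ (n + 1) := by
    rw [hr, mul_right_comm _ u, ← mul_assoc, ← pow_add, Nat.sub_add_cancel hmn]
    linear_combination -(X - C 1) ^ n * huv
  have hτ : ∀ k, aeval τ ((X - C 1) ^ k : K[X]) = (τ - 1) ^ k := by simp
  apply hp.1
  rw [← hτ, hBezout, map_add, map_mul _ _ q, map_mul _ _ ((X - C 1) ^ (n + 1)), hτ (n + 1),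
    LinearMap.add_apply, Module.End.mul_apply, Module.End.mul_apply, h, hp.2, map_zero, map_zero,
    add_zero]

lemma linearIndependent_pow (hp : HasDiffDegree τ n p) {k : ℕ} (hk : k ≤ n) :
    LinearIndependent K fun m : Fin (k + 1) => (τ ^ (m : ℕ)) p := by
  rw [Fintype.linearIndependent_iff]
  intro g hg m
  have hq : ∑ m : Fin (k + 1), C (g m) * X ^ (m : ℕ) = 0 :=
    hp.eq_zero_of_aeval
      (natDegree_sum_le_of_forall_le _ _ fun m _ =>
        (natDegree_C_mul_X_pow_le _ _).trans ((Nat.lt_succ_iff.1 m.2).trans hk))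
      (by simpa [LinearMap.sum_apply, ← smul_eq_C_mul] using hg)
  simpa [finsetSum_coeff, coeff_X_pow, Fin.val_inj] using congrArg (coeff · m) hq

end Module

variable {K R : Type*} [Field K] [CommRing R] [Algebra K R] {τ : R ≃ₐ[K] R} {n : ℕ}

lemma one [Nontrivial R] (τ : R ≃ₐ[K] R) : HasDiffDegree τ.toLinearMap 0 1 := by
  simp [HasDiffDegree]

lemma mul_invariant [IsDomain R] {p q : R} (hp : HasDiffDegree τ.toLinearMap n p) (hq : q ≠ 0)
    (hτ : τ q = q) : HasDiffDegree τ.toLinearMap n (q * p) := by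
  have hpow : ∀ k : ℕ, ((τ.toLinearMap - 1) ^ k) (q * p) = q * ((τ.toLinearMap - 1) ^ k) p := by
    intro k
    induction k with
    | zero => simp
    | succ k ih => simp [pow_succ', ih, hτ, mul_sub]
  exact ⟨by rw [hpow]; exact mul_ne_zero hq hp.1, by rw [hpow, hp.2, mul_zero]⟩

lemma sub_one_pow_linear_mul {ℓ : R} {b : K} (hτ : τ ℓ = ℓ + algebraMap K R b) (p : R) (k : ℕ) :
    ((τ.toLinearMap - 1) ^ (k + 1)) (ℓ * p) = ℓ * ((τ.toLinearMap - 1) ^ (k + 1)) p +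
      (((k + 1 : ℕ) : K) * b) • τ (((τ.toLinearMap - 1) ^ k) p) := by
  induction k with
  | zero =>
    simp only [zero_add, pow_one, pow_zero, LinearMap.sub_apply, Module.End.one_apply,
      AlgEquiv.toLinearMap_apply, map_mul, hτ, Nat.cast_one, one_mul, Algebra.smul_def]
    ring
  | succ k ih =>
    have hpow : ∀ (m : ℕ) (x : R), ((τ.toLinearMap - 1) ^ (m + 1)) x =
        τ (((τ.toLinearMap - 1) ^ m) x) - ((τ.toLinearMap - 1) ^ m) x := by
      intro m x
      rw [pow_succ']
      rfl
    rw [hpow (k + 1) (ℓ * p), ih, hpow (k + 1) p, hpow k p]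
    simp only [map_add, map_mul, hτ, map_sub, Algebra.smul_def, map_natCast, AlgEquiv.commutes]
    push_cast
    ring

variable [CharZero K]

lemma linear_mul {p ℓ : R} {b : K} (hp : HasDiffDegree τ.toLinearMap n p) (hb : b ≠ 0)
    (hτ : τ ℓ = ℓ + algebraMap K R b) : HasDiffDegree τ.toLinearMap (n + 1) (ℓ * p) := by
  refine ⟨?_, ?_⟩
  · rw [sub_one_pow_linear_mul hτ, hp.2, mul_zero, zero_add]
    refine smul_ne_zero (mul_ne_zero (Nat.cast_ne_zero.2 n.succ_ne_zero) hb) ?_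
    exact (map_ne_zero_iff τ τ.injective).2 hp.1
  · rw [sub_one_pow_linear_mul hτ, hp.2, map_zero, smul_zero, pow_succ', Module.End.mul_apply,
      hp.2, map_zero, mul_zero, zero_add]

lemma prod_linear_mul {p : R} {b : K} (hp : HasDiffDegree τ.toLinearMap n p) (hb : b ≠ 0)
    {ι : Type*} (s : Finset ι) {ℓ : ι → R} (hτ : ∀ i ∈ s, τ (ℓ i) = ℓ i + algebraMap K R b) :
    HasDiffDegree τ.toLinearMap (s.card + n) ((∏ i ∈ s, ℓ i) * p) := by
  classical
  induction s using Finset.induction_on with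
  | empty => simpa using hp
  | insert i s hi ih =>
    rw [Finset.card_insert_of_notMem hi, Finset.prod_insert hi, mul_assoc, Nat.succ_add]
    exact (ih fun j hj => hτ j (Finset.mem_insert_of_mem hj)).linear_mul hb
      (hτ i (Finset.mem_insert_self _ _))

end HasDiffDegree

end DifferenceDegree

section Ad

attribute [local instance] LieRing.ofAssociativeRing

open LieAlgebra

lemma map_ad_pow {K L L' : Type*} [CommRing K] [LieRing L] [LieAlgebra K L] [LieRing L']
    [LieAlgebra K L'] (f : L →ₗ⁅K⁆ L') (x y : L) (n : ℕ) :
    f ((ad K L x ^ n) y) = (ad K L' (f x) ^ n) (f y) := by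
  induction n with
  | zero => rfl
  | succ n ih => simp only [pow_succ', Module.End.mul_apply, ad_apply, LieHom.map_lie, ih]

lemma ad_pow_mem_wordSpan (K : Type*) {V B : Type*} [CommRing K] [Ring B] [Algebra K B] (a : V → B)
    (i j : V) (n : ℕ) :
    (ad K B (a i) ^ n) (a j) ∈ wordSpan K a (Finsupp.single i (n : ℤ) + Finsupp.single j 1) := by
  have hmem : ∀ i, a i ∈ wordSpan K a (Finsupp.single i 1) := fun i => by
    simpa using prod_mem_wordSpan K a [i]
  induction n with
  | zero => simpa using hmem j
  | succ n ih =>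
    rw [pow_succ', Module.End.mul_apply, ad_apply, LieRing.of_associative_ring_bracket,
      Nat.cast_succ, Finsupp.single_add, add_right_comm]
    refine sub_mem ?_ (mul_mem_wordSpan K ih (hmem i))
    rw [add_comm]
    exact mul_mem_wordSpan K (hmem i) ih

namespace TGWDatum

variable {K R : Type*} [Field K] [CommRing R] [Algebra K R]

@[simp]
lemma twistedMul_zero (τ : R →ₗ[K] R) : twistedMul 0 τ = 0 := by ext; simp

@[simp]
lemma twistedMul_one (τ : R →ₗ[K] R) : twistedMul 1 τ = τ := by ext; simp

lemma σ_symm_comm {I : Type*} (D : TGWDatum K R I) (i j : I) (r : R) :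
    (D.σ i).symm ((D.σ j).symm r) = (D.σ j).symm ((D.σ i).symm r) := by
  rw [AlgEquiv.symm_apply_eq, AlgEquiv.symm_apply_eq, D.σ_comm, AlgEquiv.apply_symm_apply,
    AlgEquiv.apply_symm_apply]

lemma ad_pow_twistedMul {τ υ : R ≃ₐ[K] R} (hcomm : ∀ r, τ (υ r) = υ (τ r)) (p : R) (n : ℕ) :
    (ad K (Module.End K R) τ.toLinearMap ^ n) (twistedMul p υ.toLinearMap) =
      twistedMul (((τ.toLinearMap - 1) ^ n) p) (τ.toLinearMap ^ n * υ.toLinearMap) := by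
  have hpow : ∀ (n : ℕ) r, (τ.toLinearMap ^ n) (υ (τ r)) = τ ((τ.toLinearMap ^ n) (υ r)) := by
    intro n r
    rw [← hcomm, ← AlgEquiv.toLinearMap_apply τ (υ r), ← Module.End.mul_apply, ← pow_succ,
      pow_succ']
    rfl
  induction n with
  | zero => rfl
  | succ n ih =>
    rw [pow_succ', Module.End.mul_apply, ih, ad_apply, LieRing.of_associative_ring_bracket]
    ext r
    simp only [LinearMap.sub_apply, Module.End.mul_apply, twistedMul_apply,
      AlgEquiv.toLinearMap_apply, map_mul, pow_succ', Module.End.one_apply, hpow]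
    ring

lemma linearIndependent_pow_mul_twistedMul_mul_pow {τ υ : R ≃ₐ[K] R} {p : R} {n k : ℕ}
    (hp : HasDiffDegree τ.toLinearMap n p) (hk : k ≤ n) :
    LinearIndependent K fun m : Fin (k + 1) =>
      τ.toLinearMap ^ (m : ℕ) * twistedMul p υ.toLinearMap * τ.toLinearMap ^ (k - m) := by
  refine .of_comp (LinearMap.applyₗ (1 : R)) ?_
  have hone : ∀ m : ℕ, (τ.toLinearMap ^ m) 1 = 1 := by
    intro m
    induction m with
    | zero => rfl
    | succ m ih => rw [pow_succ', Module.End.mul_apply, ih]; exact map_one τ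
  simpa [Function.comp_def, hone] using hp.linearIndependent_pow hk

namespace TwistedRep

variable [IsDomain R] {I : Type*} {D : TGWDatum K R I} {μ : I → I → Kˣ} (G : D.TwistedRep μ)
  {i j : I} {n : ℕ}

include G

lemma ad_X_pow_apply_X (hi : G.xCoeff i = 1)
    (hj : HasDiffDegree (D.σ i).toLinearMap n (G.xCoeff j)) :
    (ad K (D.TGWAlgebra μ) (D.X μ i) ^ (n + 1)) (D.X μ j) = 0 := by
  refine G.eq_zero_of_mem_deg (wordSpan_X_le_deg _ (ad_pow_mem_wordSpan K (D.X μ) i j (n + 1))) ?_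
  refine (map_ad_pow (G.rep : D.TGWAlgebra μ →ₗ⁅K⁆ Module.End K R) _ _ _).trans ?_
  rw [AlgHom.toLieHom_apply, AlgHom.toLieHom_apply, rep_X, rep_X, hi, twistedMul_one,
    ad_pow_twistedMul (D.σ_comm i j), hj.2, twistedMul_zero]

lemma ad_Y_pow_apply_Y (hi : G.yCoeff i = 1)
    (hj : HasDiffDegree (D.σ i).symm.toLinearMap n (G.yCoeff j)) :
    (ad K (D.TGWAlgebra μ) (D.Y μ i) ^ (n + 1)) (D.Y μ j) = 0 := by
  refine G.eq_zero_of_mem_deg (wordSpan_Y_le_deg _ (ad_pow_mem_wordSpan K (D.Y μ) i j (n + 1))) ?_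
  refine (map_ad_pow (G.rep : D.TGWAlgebra μ →ₗ⁅K⁆ Module.End K R) _ _ _).trans ?_
  rw [AlgHom.toLieHom_apply, AlgHom.toLieHom_apply, rep_Y, rep_Y, hi, twistedMul_one,
    ad_pow_twistedMul (D.σ_symm_comm i j), hj.2, twistedMul_zero]

lemma linearIndependent_X_pow_mul_X_mul_X_pow (hi : G.xCoeff i = 1)
    (hj : HasDiffDegree (D.σ i).toLinearMap n (G.xCoeff j)) {k : ℕ} (hk : k ≤ n) :
    LinearIndependent K fun m : Fin (k + 1) =>
      D.X μ i ^ (m : ℕ) * D.X μ j * D.X μ i ^ (k - m) := by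
  refine .of_comp G.rep.toLinearMap ?_
  simpa [Function.comp_def, hi] using
    linearIndependent_pow_mul_twistedMul_mul_pow (υ := D.σ j) hj hk

lemma linearIndependent_Y_pow_mul_Y_mul_Y_pow (hi : G.yCoeff i = 1)
    (hj : HasDiffDegree (D.σ i).symm.toLinearMap n (G.yCoeff j)) {k : ℕ} (hk : k ≤ n) :
    LinearIndependent K fun m : Fin (k + 1) =>
      D.Y μ i ^ (m : ℕ) * D.Y μ j * D.Y μ i ^ (k - m) := by
  refine .of_comp G.rep.toLinearMap ?_
  simpa [Function.comp_def, hi] using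
    linearIndependent_pow_mul_twistedMul_mul_pow (υ := (D.σ j).symm) hj hk

end TwistedRep

end TGWDatum

end Ad

/-! ### Multiquivers -/

section RisingProduct

variable {R S : Type*} [CommRing R] [CommRing S]

/-- The product `x (x + 1) ⋯ (x + n - 1)`. The falling product `(x - 1) ⋯ (x - n)` is
`risingProd (x - n) n`. -/
def risingProd (x : R) (n : ℕ) : R := ∏ k ∈ Finset.range n, (x + k)

@[simp]
lemma risingProd_zero (x : R) : risingProd x 0 = 1 := rfl

lemma map_risingProd {F : Type*} [FunLike F R S] [RingHomClass F R S] (f : F) (x : R) (n : ℕ) :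
    f (risingProd x n) = risingProd (f x) n := by
  simp [risingProd]

lemma risingProd_add (x : R) (m n : ℕ) :
    risingProd x (m + n) = risingProd x m * risingProd (x + m) n := by
  simp [risingProd, Finset.prod_range_add, add_assoc]

lemma risingProd_mul_risingProd_add_comm (x : R) (m n : ℕ) :
    risingProd x m * risingProd (x + m) n = risingProd x n * risingProd (x + n) m := by
  rw [← risingProd_add, ← risingProd_add, add_comm]

lemma risingProd_sub_mul_risingProd_sub_comm (x : R) (m n : ℕ) :
    risingProd (x - m) m * risingProd (x - m - n) n =
      risingProd (x - n) n * risingProd (x - n - m) m := by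
  have h := risingProd_mul_risingProd_add_comm (x - m - n) n m
  rw [sub_add_cancel, (by ring : x - m - n + m = x - n)] at h
  rw [mul_comm, h, mul_comm, sub_right_comm]

lemma prod_sub_eq_risingProd (x : R) (n : ℕ) :
    ∏ k ∈ Finset.range n, (x - (k + 1)) = risingProd (x - n) n := by
  rw [risingProd, ← Finset.prod_range_reflect]
  refine Finset.prod_congr rfl fun k hk => ?_
  rw [Nat.sub_sub, Nat.cast_sub (by have := Finset.mem_range.1 hk; omega)]
  push_cast
  ring

lemma HasDiffDegree.risingProd_mul {K : Type*} [Field K] [CharZero K] [Algebra K R] {τ : R ≃ₐ[K] R}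
    {n : ℕ} {p ℓ : R} {b : K} (hp : HasDiffDegree τ.toLinearMap n p) (hb : b ≠ 0)
    (hτ : τ ℓ = ℓ + algebraMap K R b) (m : ℕ) :
    HasDiffDegree τ.toLinearMap (m + n) (risingProd ℓ m * p) := by
  have hstep (k : ℕ) : τ (ℓ + k) = ℓ + k + algebraMap K R b := by
    rw [map_add, map_natCast, hτ, add_right_comm]
  simpa [risingProd] using
    hp.prod_linear_mul hb (Finset.range m) (ℓ := fun k => ℓ + k) fun k _ => hstep k

end RisingProduct

namespace Multiquiver

variable {V E : Type*} (Γ : Multiquiver V E)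

lemma endMult_ne_zero_iff {v : V} {o : Option (V × ℕ+)} :
    endMult v o ≠ 0 ↔ ∃ n, o = some (v, n) := by
  rcases o with _ | ⟨w, n⟩
  · simp [endMult]
  · by_cases h : w = v <;> simp [endMult, h]

lemma endMult_eq_zero_or_of_ne {v w : V} (h : v ≠ w) (o : Option (V × ℕ+)) :
    endMult v o = 0 ∨ endMult w o = 0 := by
  by_contra! hne
  obtain ⟨n, hv⟩ := endMult_ne_zero_iff.1 hne.1
  obtain ⟨m, hw⟩ := endMult_ne_zero_iff.1 hne.2
  rw [hv] at hw
  simp_all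

lemma endMult_s_eq_zero_or_endMult_t_eq_zero (e : E) (v : V) :
    endMult v (Γ.s e) = 0 ∨ endMult v (Γ.t e) = 0 := by
  by_contra! hne
  obtain ⟨n, hs⟩ := endMult_ne_zero_iff.1 hne.1
  obtain ⟨m, ht⟩ := endMult_ne_zero_iff.1 hne.2
  exact Γ.no_loops e v v n m hs ht rfl

lemma mem_edgesAt {e : E} {v : V} :
    e ∈ Γ.edgesAt v ↔ endMult v (Γ.s e) ≠ 0 ∨ endMult v (Γ.t e) ≠ 0 := by
  rw [edgesAt, Set.Finite.mem_toFinset, endMult_ne_zero_iff, endMult_ne_zero_iff]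
  rfl

lemma notMem_edgesAt {e : E} {v : V} :
    e ∉ Γ.edgesAt v ↔ endMult v (Γ.s e) = 0 ∧ endMult v (Γ.t e) = 0 := by
  rw [mem_edgesAt, not_or, not_not, not_not]

lemma natAbs_incidence (e : E) (v : V) :
    (Γ.incidence e v).natAbs = endMult v (Γ.s e) + endMult v (Γ.t e) := by
  have := Γ.endMult_s_eq_zero_or_endMult_t_eq_zero e v
  rw [incidence]
  omega

open Classical in
/-- The total multiplicity at `j` of the edges between `i` and `j`. -/
noncomputable def mult (i j : V) : ℕ :=
  ∑ e ∈ Γ.edgesAt i ∩ Γ.edgesAt j, (Γ.incidence e j).natAbs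

lemma cartan_eq_neg_mult {i j : V} (hij : i ≠ j) : Γ.cartan i j = -(Γ.mult i j : ℤ) := by
  simp [cartan, hij, mult]

lemma mult_eq_zero_iff {i j : V} :
    Γ.mult i j = 0 ↔ ∀ e, e ∈ Γ.edgesAt i → e ∉ Γ.edgesAt j := by
  simp only [mult, Finset.sum_eq_zero_iff, Finset.mem_inter, natAbs_incidence, add_eq_zero,
    ← notMem_edgesAt]
  tauto

/-- The multiquiver with all edges reversed. It exchanges the roles of the `X v` and the `Y v`. -/
def reverse : Multiquiver V E where
  s := Γ.t
  t := Γ.s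
  no_loops e u v m n hs ht := (Γ.no_loops e v u n m ht hs).symm
  finite_s := Γ.finite_t
  finite_t := Γ.finite_s

lemma edgesAt_reverse (v : V) : Γ.reverse.edgesAt v = Γ.edgesAt v := by
  ext e
  rw [mem_edgesAt, mem_edgesAt, or_comm]
  rfl

lemma incidence_reverse (e : E) (v : V) : Γ.reverse.incidence e v = -Γ.incidence e v :=
  (neg_sub _ _).symm

lemma mult_reverse (i j : V) : Γ.reverse.mult i j = Γ.mult i j := by
  simp [mult, edgesAt_reverse, incidence_reverse]

section TwistedRep

variable (K : Type*) [Field K]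

lemma sigma_X (v : V) (e : E) : Γ.sigma K v (MvPolynomial.X e) =
    MvPolynomial.X e + (endMult v (Γ.s e) : MvPolynomial E K) -
      (endMult v (Γ.t e) : MvPolynomial E K) := by
  simp [sigma, incidence, sub_sub_eq_add_sub]

lemma sigma_symm_X (v : V) (e : E) : (Γ.sigma K v).symm (MvPolynomial.X e) =
    MvPolynomial.X e + (endMult v (Γ.t e) : MvPolynomial E K) -
      (endMult v (Γ.s e) : MvPolynomial E K) := by
  rw [AlgEquiv.symm_apply_eq, map_sub, map_add, sigma_X, map_natCast, map_natCast]
  ring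

lemma sigma_reverse (v : V) : Γ.reverse.sigma K v = (Γ.sigma K v).symm := by
  refine AlgEquiv.coe_toAlgHom_injective (MvPolynomial.algHom_ext fun e => ?_)
  exact (sigma_X Γ.reverse K v e).trans (Γ.sigma_symm_X K v e).symm

lemma uFactor_eq_risingProd (e : E) (v : V) : Γ.uFactor K e v =
    risingProd (MvPolynomial.X e) (endMult v (Γ.t e)) *
      risingProd (MvPolynomial.X e - (endMult v (Γ.s e) : MvPolynomial E K))
        (endMult v (Γ.s e)) := by
  rw [← prod_sub_eq_risingProd]
  simp [uFactor, risingProd]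

open Classical in
/-- The factor at the edge `e` of the coefficient by which `X v` acts on polynomials. Edges in `B`
act by a pure shift at their source, the other edges at their target. -/
noncomputable def xFactor (B : Set E) (e : E) (v : V) : MvPolynomial E K :=
  if e ∈ B then risingProd (MvPolynomial.X e - (endMult v (Γ.t e) : MvPolynomial E K))
    (endMult v (Γ.t e))
  else risingProd (MvPolynomial.X e) (endMult v (Γ.s e))

/-- The coefficient by which `X v` acts on polynomials; `Y v` acts with the coefficient of the
reversed multiquiver. -/
noncomputable def xCoeff (B : Set E) (v : V) : MvPolynomial E K :=
  ∏ e ∈ Γ.edgesAt v, Γ.xFactor K B e v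

variable {K} in
lemma xFactor_eq_one {B : Set E} {e : E} {v : V} (h : e ∉ Γ.edgesAt v) :
    Γ.xFactor K B e v = 1 := by
  simp [xFactor, Γ.notMem_edgesAt.1 h]

variable (B : Set E)

lemma xCoeff_eq_prod_of_subset {v : V} {S : Finset E} (hS : Γ.edgesAt v ⊆ S) :
    Γ.xCoeff K B v = ∏ e ∈ S, Γ.xFactor K B e v :=
  Finset.prod_subset hS fun _ _ h => Γ.xFactor_eq_one h

lemma xFactor_reverse_mul_sigma_symm_xFactor (e : E) (v : V) :
    Γ.reverse.xFactor K B e v * (Γ.sigma K v).symm (Γ.xFactor K B e v) = Γ.uFactor K e v := by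
  have hst := Γ.endMult_s_eq_zero_or_endMult_t_eq_zero e v
  rw [uFactor_eq_risingProd, xFactor, xFactor]
  split_ifs <;> rcases hst with h | h <;>
    simp [reverse, map_risingProd, sigma_symm_X, h]

lemma xFactor_mul_sigma_xFactor_reverse (e : E) {v w : V} (hvw : v ≠ w) :
    Γ.xFactor K B e v * Γ.sigma K v (Γ.reverse.xFactor K B e w) =
      Γ.reverse.xFactor K B e w * (Γ.sigma K w).symm (Γ.xFactor K B e v) := by
  have hs := endMult_eq_zero_or_of_ne hvw (Γ.s e)
  have ht := endMult_eq_zero_or_of_ne hvw (Γ.t e)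
  rw [xFactor, xFactor]
  split_ifs <;> rcases hs with hs | hs <;> rcases ht with ht | ht <;>
    simp [reverse, map_risingProd, sigma_symm_X, sigma_X, hs, ht,
      risingProd_sub_mul_risingProd_sub_comm _ (endMult v (Γ.t e)),
      risingProd_mul_risingProd_add_comm _ (endMult v (Γ.s e))]

/-- The action of the construction on polynomials with the coefficients `xCoeff`. -/
noncomputable def twistedRep : (Γ.datum K).TwistedRep fun _ _ => 1 where
  xCoeff := Γ.xCoeff K B
  yCoeff := Γ.reverse.xCoeff K B
  Y_X v := by
    rw [xCoeff, xCoeff, edgesAt_reverse, map_prod, ← Finset.prod_mul_distrib]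
    exact Finset.prod_congr rfl fun e _ => Γ.xFactor_reverse_mul_sigma_symm_xFactor K B e v
  X_Y v w hvw := by
    classical
    rw [Γ.xCoeff_eq_prod_of_subset K B (S := Γ.edgesAt v ∪ Γ.edgesAt w) Finset.subset_union_left,
      Γ.reverse.xCoeff_eq_prod_of_subset K B (S := Γ.edgesAt v ∪ Γ.edgesAt w)
        (by rw [edgesAt_reverse]; exact Finset.subset_union_right),
      map_prod, map_prod, ← Finset.prod_mul_distrib, ← Finset.prod_mul_distrib, Units.val_one,
      one_smul]
    exact Finset.prod_congr rfl fun e _ => Γ.xFactor_mul_sigma_xFactor_reverse K B e hvw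

variable {K} in
lemma risingProd_X_sub_ne_zero (e : E) (c n : ℕ) :
    risingProd (MvPolynomial.X e - (c : MvPolynomial E K)) n ≠ 0 := by
  refine Finset.prod_ne_zero_iff.2 fun k _ h => ?_
  have heval := congrArg (MvPolynomial.eval fun _ => (c : K) - k + 1) h
  simp only [map_add, map_sub, map_natCast, MvPolynomial.eval_X, map_zero] at heval
  exact one_ne_zero (by linear_combination heval)

variable {K} in
lemma exists_xFactor_eq_risingProd (B : Set E) (e : E) (v : V) :
    ∃ c n : ℕ, Γ.xFactor K B e v = risingProd (MvPolynomial.X e - (c : MvPolynomial E K)) n := by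
  rw [xFactor]
  split_ifs
  · exact ⟨_, _, rfl⟩
  · exact ⟨0, _, by rw [Nat.cast_zero, sub_zero]⟩

/-- The edges with source `v`. -/
def sourceEdges (v : V) : Set E := {e | endMult v (Γ.s e) ≠ 0}

lemma xCoeff_sourceEdges_self (i : V) : Γ.xCoeff K (Γ.sourceEdges i) i = 1 := by
  refine Finset.prod_eq_one fun e _ => ?_
  rw [xFactor]
  split_ifs with h
  · simp [(Γ.endMult_s_eq_zero_or_endMult_t_eq_zero e i).resolve_left h]
  · simp [not_not.1 h]

variable {K} in
lemma exists_xFactor_sourceEdges_eq_risingProd {i j : V} (hij : i ≠ j) {e : E}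
    (hi : e ∈ Γ.edgesAt i) : ∃ c : ℕ, Γ.xFactor K (Γ.sourceEdges i) e j =
      risingProd (MvPolynomial.X e - (c : MvPolynomial E K)) (Γ.incidence e j).natAbs := by
  have hs := endMult_eq_zero_or_of_ne hij (Γ.s e)
  have ht := endMult_eq_zero_or_of_ne hij (Γ.t e)
  rw [natAbs_incidence, xFactor]
  split_ifs with h
  · exact ⟨endMult j (Γ.t e), by rw [hs.resolve_left h, zero_add]⟩
  · have hti := (Γ.mem_edgesAt.1 hi).resolve_left h
    exact ⟨0, by rw [ht.resolve_left hti, add_zero, Nat.cast_zero, sub_zero]⟩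

variable [CharZero K]

lemma hasDiffDegree_prod_xFactor {i j : V} (hij : i ≠ j) {S : Finset E}
    (hS : S ⊆ Γ.edgesAt i) :
    HasDiffDegree (Γ.sigma K i).toLinearMap (∑ e ∈ S, (Γ.incidence e j).natAbs)
      (∏ e ∈ S, Γ.xFactor K (Γ.sourceEdges i) e j) := by
  classical
  induction S using Finset.induction_on with
  | empty => simpa using HasDiffDegree.one (Γ.sigma K i)
  | insert e S he ih =>
    obtain ⟨hei, hSi⟩ := Finset.insert_subset_iff.1 hS
    obtain ⟨c, hc⟩ := Γ.exists_xFactor_sourceEdges_eq_risingProd (K := K) hij hei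
    have hne : (endMult i (Γ.s e) : K) - endMult i (Γ.t e) ≠ 0 := by
      rw [sub_ne_zero, Nat.cast_injective.ne_iff]
      have := Γ.mem_edgesAt.1 hei
      have := Γ.endMult_s_eq_zero_or_endMult_t_eq_zero e i
      omega
    rw [Finset.sum_insert he, Finset.prod_insert he, hc]
    refine (ih hSi).risingProd_mul hne ?_ _
    rw [map_sub, sigma_X, map_natCast, map_sub, map_natCast, map_natCast]
    ring

lemma hasDiffDegree_xCoeff {i j : V} (hij : i ≠ j) :
    HasDiffDegree (Γ.sigma K i).toLinearMap (Γ.mult i j) (Γ.xCoeff K (Γ.sourceEdges i) j) := by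
  classical
  rw [xCoeff, ← Finset.prod_sdiff (Finset.inter_subset_right (s₁ := Γ.edgesAt i))]
  have hinter := Γ.hasDiffDegree_prod_xFactor K hij
    (Finset.inter_subset_left (s₂ := Γ.edgesAt j))
  refine .mul_invariant (by rw [mult]; convert hinter) ?_ ?_
  · refine Finset.prod_ne_zero_iff.2 fun e _ => ?_
    obtain ⟨c, n, h⟩ := Γ.exists_xFactor_eq_risingProd (K := K) (Γ.sourceEdges i) e j
    exact h ▸ risingProd_X_sub_ne_zero e c n
  · rw [map_prod]
    refine Finset.prod_congr rfl fun e he => ?_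
    have hei : e ∉ Γ.edgesAt i := fun hei =>
      (Finset.mem_sdiff.1 he).2 (Finset.mem_inter.2 ⟨hei, (Finset.mem_sdiff.1 he).1⟩)
    obtain ⟨c, n, h⟩ := Γ.exists_xFactor_eq_risingProd (K := K) (Γ.sourceEdges i) e j
    obtain ⟨hs, ht⟩ := Γ.notMem_edgesAt.1 hei
    rw [h, map_risingProd, map_sub, sigma_X, hs, ht, map_natCast, Nat.cast_zero, add_zero, sub_zero]

end TwistedRep

lemma wordSpan_X_le_algDeg {K : Type*} [Field K] (d : V →₀ ℤ) :
    wordSpan K (Γ.X K) d ≤ Γ.algDeg K d :=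
  TGWDatum.wordSpan_X_le_deg d

lemma wordSpan_Y_le_algDeg {K : Type*} [Field K] (d : V →₀ ℤ) :
    wordSpan K (Γ.Y K) (-d) ≤ Γ.algDeg K d :=
  (TGWDatum.wordSpan_Y_le_deg (-d)).trans_eq (congrArg (Γ.algDeg K) (neg_neg d))

section Relations

attribute [local instance] LieRing.ofAssociativeRing

open LieAlgebra

variable {K : Type*} [Field K] [CharZero K] {i j : V}

lemma toNat_one_sub_cartan (hij : i ≠ j) : (1 - Γ.cartan i j).toNat = Γ.mult i j + 1 := by
  rw [Γ.cartan_eq_neg_mult hij]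
  omega

lemma hasDiffDegree_xCoeff_reverse (hij : i ≠ j) :
    HasDiffDegree (Γ.sigma K i).symm.toLinearMap (Γ.mult i j)
      (Γ.reverse.xCoeff K (Γ.reverse.sourceEdges i) j) := by
  simpa only [sigma_reverse, mult_reverse] using Γ.reverse.hasDiffDegree_xCoeff K hij

lemma serre_X (hij : i ≠ j) :
    (ad K (Γ.Alg K) (Γ.X K i) ^ (1 - Γ.cartan i j).toNat) (Γ.X K j) = 0 := by
  rw [Γ.toNat_one_sub_cartan hij]
  exact (Γ.twistedRep K _).ad_X_pow_apply_X (Γ.xCoeff_sourceEdges_self K i)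
    (Γ.hasDiffDegree_xCoeff K hij)

lemma serre_Y (hij : i ≠ j) :
    (ad K (Γ.Alg K) (Γ.Y K i) ^ (1 - Γ.cartan i j).toNat) (Γ.Y K j) = 0 := by
  rw [Γ.toNat_one_sub_cartan hij]
  exact (Γ.twistedRep K _).ad_Y_pow_apply_Y (Γ.reverse.xCoeff_sourceEdges_self K i)
    (Γ.hasDiffDegree_xCoeff_reverse hij)

lemma linearIndependent_X_words (hij : i ≠ j) {k : ℕ} (hk : (k : ℤ) ≤ -Γ.cartan i j) :
    LinearIndependent K fun m : Fin (k + 1) =>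
      Γ.X K i ^ (m : ℕ) * Γ.X K j * Γ.X K i ^ (k - m) := by
  rw [Γ.cartan_eq_neg_mult hij, neg_neg, Nat.cast_le] at hk
  exact (Γ.twistedRep K _).linearIndependent_X_pow_mul_X_mul_X_pow
    (Γ.xCoeff_sourceEdges_self K i) (Γ.hasDiffDegree_xCoeff K hij) hk

lemma linearIndependent_Y_words (hij : i ≠ j) {k : ℕ} (hk : (k : ℤ) ≤ -Γ.cartan i j) :
    LinearIndependent K fun m : Fin (k + 1) =>
      Γ.Y K i ^ (m : ℕ) * Γ.Y K j * Γ.Y K i ^ (k - m) := by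
  rw [Γ.cartan_eq_neg_mult hij, neg_neg, Nat.cast_le] at hk
  exact (Γ.twistedRep K _).linearIndependent_Y_pow_mul_Y_mul_Y_pow
    (Γ.reverse.xCoeff_sourceEdges_self K i) (Γ.hasDiffDegree_xCoeff_reverse hij) hk

end Relations

end Multiquiver

/-! ### Homomorphisms from Kac–Moody algebras -/

section KacMoody

/-- A generalized Cartan matrix with possibly infinite index set. -/
structure IsGeneralizedCartan {V : Type*} (A : V → V → ℤ) : Prop where
  diag : ∀ i, A i i = 2
  nonpos : ∀ i j, i ≠ j → A i j ≤ 0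
  zero_symm : ∀ i j, A i j = 0 → A j i = 0

lemma Multiquiver.isGeneralizedCartan_cartan {V E : Type*} (Γ : Multiquiver V E) :
    IsGeneralizedCartan Γ.cartan where
  diag i := by simp [cartan]
  nonpos i j hij := by rw [Γ.cartan_eq_neg_mult hij]; omega
  zero_symm i j h := by
    by_cases hij : i = j
    · rwa [← hij] at h ⊢
    · rw [Γ.cartan_eq_neg_mult hij, neg_eq_zero, Nat.cast_eq_zero, mult_eq_zero_iff] at h
      rw [Γ.cartan_eq_neg_mult (Ne.symm hij), neg_eq_zero, Nat.cast_eq_zero, mult_eq_zero_iff]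
      exact fun e hj hi => h e hi hj

open LieAlgebra

section AdPow

variable {K L : Type*} [CommRing K] [LieRing L] [LieAlgebra K L]

lemma lie_ad_pow_of_lie_eq_smul {h e v : L} {a b : K} (he : ⁅h, e⁆ = a • e) (hv : ⁅h, v⁆ = b • v)
    (n : ℕ) : ⁅h, (ad K L e ^ n) v⁆ = (b + n * a) • (ad K L e ^ n) v := by
  induction n with
  | zero => simpa using hv
  | succ n ih =>
    rw [pow_succ', Module.End.mul_apply, ad_apply, leibniz_lie, ih, he, smul_lie, lie_smul,
      ← add_smul]
    push_cast
    ring_nf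

lemma lie_ad_pow_of_lie_eq_zero {e f : L} (hfe : ⁅f, e⁆ = 0) (v : L) (n : ℕ) :
    ⁅f, (ad K L e ^ n) v⁆ = (ad K L e ^ n) ⁅f, v⁆ := by
  induction n with
  | zero => rfl
  | succ n ih =>
    rw [pow_succ', Module.End.mul_apply, ad_apply, leibniz_lie, ih, hfe, zero_lie, zero_add,
      Module.End.mul_apply, ad_apply]

lemma lie_ad_pow_succ_of_sl2 {h e f v : L} {c : K} (hef : ⁅e, f⁆ = h) (he : ⁅h, e⁆ = (2 : K) • e)
    (hfv : ⁅f, v⁆ = 0) (hv : ⁅h, v⁆ = c • v) (n : ℕ) :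
    ⁅f, (ad K L e ^ (n + 1)) v⁆ = (-((n + 1) * (c + n))) • (ad K L e ^ n) v := by
  have hfe : ⁅f, e⁆ = -h := by rw [← lie_skew, hef]
  induction n with
  | zero => simp [leibniz_lie f, hfv, hfe, hv]
  | succ n ih =>
    rw [pow_succ', Module.End.mul_apply, ad_apply, leibniz_lie, ih, hfe, neg_lie,
      lie_ad_pow_of_lie_eq_smul he hv, lie_smul, ← neg_smul, pow_succ', Module.End.mul_apply,
      ad_apply, ← add_smul]
    push_cast
    ring_nf

end AdPow

namespace Realization

variable {K : Type*} [Field K] {V : Type*} {A : V → V → ℤ} {𝔥 : Type*} [AddCommGroup 𝔥]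
  [Module K 𝔥]

/-- Elements of a Lie algebra that satisfy the defining relations of the Kac–Moody algebra except
possibly the Serre relations. -/
structure Chevalley (ρ : Realization K A 𝔥) (L : Type*) [LieRing L] [LieAlgebra K L] where
  h : 𝔥 →ₗ[K] L
  e : V → L
  f : V → L
  lie_h_h (x y : 𝔥) : ⁅h x, h y⁆ = 0
  lie_e_f_self (i : V) : ⁅e i, f i⁆ = h (ρ.coroot i)
  lie_e_f_of_ne (i j : V) (hij : i ≠ j) : ⁅e i, f j⁆ = 0
  lie_h_e (x : 𝔥) (i : V) : ⁅h x, e i⁆ = ρ.root i x • e i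
  lie_h_f (x : 𝔥) (i : V) : ⁅h x, f i⁆ = (-ρ.root i x) • f i

namespace Chevalley

variable {ρ : Realization K A 𝔥} {L L' : Type*} [LieRing L] [LieAlgebra K L] [LieRing L']
  [LieAlgebra K L'] (S : ρ.Chevalley L)

lemma lie_f_e_of_ne {i j : V} (hij : i ≠ j) : ⁅S.f i, S.e j⁆ = 0 := by
  rw [← lie_skew, S.lie_e_f_of_ne j i hij.symm, neg_zero]

lemma lie_h_coroot_e (i j : V) : ⁅S.h (ρ.coroot i), S.e j⁆ = (A i j : K) • S.e j := by
  rw [S.lie_h_e, ρ.pairing]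

/-- The element whose vanishing is the Serre relation between `e i` and `e j`. -/
noncomputable def serreE (i j : V) : L := (ad K L (S.e i) ^ (1 - A i j).toNat) (S.e j)

/-- The Chevalley involution `e i ↦ f i`, `f i ↦ e i`, `x ↦ -x`. -/
def swap : ρ.Chevalley L where
  h := -S.h
  e := S.f
  f := S.e
  lie_h_h x y := by simp [S.lie_h_h]
  lie_e_f_self i := by rw [← lie_skew, S.lie_e_f_self, LinearMap.neg_apply]
  lie_e_f_of_ne i j hij := S.lie_f_e_of_ne hij
  lie_h_e x i := by rw [LinearMap.neg_apply, neg_lie, S.lie_h_f, neg_smul, neg_neg]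
  lie_h_f x i := by rw [LinearMap.neg_apply, neg_lie, S.lie_h_e, neg_smul]

/-- The image under a homomorphism of Lie algebras. -/
def map (φ : L →ₗ⁅K⁆ L') : ρ.Chevalley L' where
  h := φ ∘ₗ S.h
  e i := φ (S.e i)
  f i := φ (S.f i)
  lie_h_h x y := by simp [← LieHom.map_lie, S.lie_h_h]
  lie_e_f_self i := by simp [← LieHom.map_lie, S.lie_e_f_self]
  lie_e_f_of_ne i j hij := by simp [← LieHom.map_lie, S.lie_e_f_of_ne i j hij]
  lie_h_e x i := by simp [← LieHom.map_lie, S.lie_h_e]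
  lie_h_f x i := by simp [← LieHom.map_lie, S.lie_h_f]

lemma serreE_map (φ : L →ₗ⁅K⁆ L') (i j : V) : (S.map φ).serreE i j = φ (S.serreE i j) :=
  (map_ad_pow φ _ _ _).symm

/-- The same elements, in a Lie subalgebra that contains them. -/
def codRestrict (P : LieSubalgebra K L) (hh : ∀ x, S.h x ∈ P) (he : ∀ i, S.e i ∈ P)
    (hf : ∀ i, S.f i ∈ P) : ρ.Chevalley P where
  h := S.h.codRestrict P.toSubmodule hh
  e i := ⟨S.e i, he i⟩
  f i := ⟨S.f i, hf i⟩
  lie_h_h x y := Subtype.ext (S.lie_h_h x y)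
  lie_e_f_self i := Subtype.ext (S.lie_e_f_self i)
  lie_e_f_of_ne i j hij := Subtype.ext (S.lie_e_f_of_ne i j hij)
  lie_h_e x i := Subtype.ext (S.lie_h_e x i)
  lie_h_f x i := Subtype.ext (S.lie_h_f x i)

lemma lie_h_serreE (x : 𝔥) (i j : V) : ⁅S.h x, S.serreE i j⁆ =
    (ρ.root j x + (1 - A i j).toNat * ρ.root i x) • S.serreE i j :=
  lie_ad_pow_of_lie_eq_smul (S.lie_h_e x i) (S.lie_h_e x j) _

lemma lie_f_serreE (hA : IsGeneralizedCartan A) {i j : V} (hij : i ≠ j) (k : V) :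
    ⁅S.f k, S.serreE i j⁆ = 0 := by
  obtain ⟨n, hn⟩ : ∃ n : ℕ, A i j = -n := ⟨(-A i j).toNat, by have := hA.nonpos i j hij; omega⟩
  have hN : (1 - A i j).toNat = n + 1 := by omega
  rw [serreE, hN]
  by_cases hki : k = i
  · subst hki
    rw [lie_ad_pow_succ_of_sl2 (c := (A k j : K)) (S.lie_e_f_self k)
      (by rw [lie_h_coroot_e, hA.diag, Int.cast_ofNat]) (S.lie_f_e_of_ne hij)
      (S.lie_h_coroot_e k j), hn]
    simp
  rw [lie_ad_pow_of_lie_eq_zero (S.lie_f_e_of_ne hki)]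
  by_cases hkj : k = j
  · subst hkj
    have hei : ⁅S.e i, ⁅S.f k, S.e k⁆⁆ = (A k i : K) • S.e i := by
      rw [← lie_skew (S.f k), S.lie_e_f_self, lie_neg, lie_skew, lie_h_coroot_e]
    rw [pow_succ, Module.End.mul_apply, ad_apply, hei, map_smul]
    cases n with
    | zero => rw [hA.zero_symm i k (by simpa using hn), Int.cast_zero, zero_smul]
    | succ n => rw [pow_succ, Module.End.mul_apply, ad_apply, lie_self, map_zero, smul_zero]
  · rw [S.lie_f_e_of_ne hkj, map_zero]

end Chevalley

section Lift

variable {ρ : Realization K A 𝔥} {L : Type*} [LieRing L] [LieAlgebra K L]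

/-- The value of `S` on a generator. -/
def Chevalley.onGen (S : ρ.Chevalley L) : Gen V 𝔥 → L
  | .h x => S.h x
  | .e i => S.e i
  | .f i => S.f i

lemma Chevalley.freeLift_relator (S : ρ.Chevalley L) (he : ∀ i j, i ≠ j → S.serreE i j = 0)
    (hf : ∀ i j, i ≠ j → S.swap.serreE i j = 0) {x : FreeLieAlgebra K (Gen V 𝔥)}
    (hx : ρ.Relator x) : FreeLieAlgebra.lift K S.onGen x = 0 := by
  have hgen (g : Gen V 𝔥) : FreeLieAlgebra.lift K S.onGen (Gen.free K g) = S.onGen g :=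
    FreeLieAlgebra.lift_of_apply _ g
  cases hx with
  | h_add x y => simp [hgen, onGen]
  | h_smul c x => simp [hgen, onGen]
  | h_h x y => simp [hgen, onGen, S.lie_h_h]
  | e_f i => simp [hgen, onGen, S.lie_e_f_self]
  | e_f_ne i j hij => simp [hgen, onGen, S.lie_e_f_of_ne i j hij]
  | h_e x i => simp [hgen, onGen, S.lie_h_e]
  | h_f x i => simp [hgen, onGen, S.lie_h_f]
  | serre_e i j hij => rw [map_ad_pow, hgen, hgen]; exact he i j hij
  | serre_f i j hij => rw [map_ad_pow, hgen, hgen]; exact hf i j hij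

/-- The homomorphism from the Kac–Moody algebra given by elements that satisfy all of its defining
relations. -/
noncomputable def Chevalley.lift (S : ρ.Chevalley L) (he : ∀ i j, i ≠ j → S.serreE i j = 0)
    (hf : ∀ i j, i ≠ j → S.swap.serreE i j = 0) : ρ.KacMoody →ₗ⁅K⁆ L :=
  { ρ.ideal.toSubmodule.liftQ (FreeLieAlgebra.lift K S.onGen).toLinearMap <|
      have hle : ρ.ideal ≤ (FreeLieAlgebra.lift K S.onGen).ker :=
        LieSubmodule.lieSpan_le.2 fun _ hx => LieHom.mem_ker.2 (S.freeLift_relator he hf hx)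
      fun _ hx => LieHom.mem_ker.1 (hle hx) with
    map_lie' := by
      rintro ⟨x⟩ ⟨y⟩
      exact LieHom.map_lie (FreeLieAlgebra.lift K S.onGen) x y }

lemma Chevalley.lift_gen (S : ρ.Chevalley L) (he : ∀ i j, i ≠ j → S.serreE i j = 0)
    (hf : ∀ i j, i ≠ j → S.swap.serreE i j = 0) (g : Gen V 𝔥) :
    S.lift he hf (ρ.gen g) = S.onGen g :=
  FreeLieAlgebra.lift_of_apply _ g

end Lift

end Realization

end KacMoody

/-! ### The lowest weight Verma module -/

section WordModule

attribute [local instance] LieRing.ofAssociativeRing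

open LieAlgebra

namespace Realization

variable {K : Type*} [Field K] {V : Type*} {A : V → V → ℤ} {𝔥 : Type*} [AddCommGroup 𝔥]
  [Module K 𝔥] (ρ : Realization K A 𝔥)

lemma word_hom_ext {M : Type*} [AddCommGroup M] [Module K M] {φ ψ : (List V →₀ K) →ₗ[K] M}
    (h : ∀ w, φ (Finsupp.single w 1) = ψ (Finsupp.single w 1)) : φ = ψ :=
  Finsupp.lhom_ext' fun w => LinearMap.ext_ring (h w)

variable (K) in
/-- The action of `e i` on the lowest weight Verma module of lowest weight zero, which is the free
module on words in the letters `e i`. -/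
noncomputable def wordE (i : V) : Module.End K (List V →₀ K) :=
  Finsupp.lmapDomain K K (List.cons i)

@[simp]
lemma wordE_single (i : V) (w : List V) (c : K) :
    wordE K i (Finsupp.single w c) = Finsupp.single (i :: w) c := by simp [wordE]

/-- The action of `𝔥` on the lowest weight Verma module. -/
noncomputable def wordH : 𝔥 →ₗ[K] Module.End K (List V →₀ K) where
  toFun x := Finsupp.linearCombination K fun w => (w.map ρ.root).sum x • Finsupp.single w 1
  map_add' x y := word_hom_ext fun w => by simp [add_smul]
  map_smul' c x := word_hom_ext fun w => by simp

lemma wordH_single (x : 𝔥) (w : List V) (c : K) :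
    ρ.wordH x (Finsupp.single w c) = (w.map ρ.root).sum x • Finsupp.single w c := by
  simp [wordH, mul_comm]

open Classical in
/-- The value of `f i` on a word in the lowest weight Verma module. -/
noncomputable def wordFAux (i : V) : List V → (List V →₀ K)
  | [] => 0
  | j :: w => wordE K j (wordFAux i w) -
      if i = j then ρ.wordH (ρ.coroot i) (Finsupp.single w 1) else 0

/-- The action of `f i` on the lowest weight Verma module. -/
noncomputable def wordF (i : V) : Module.End K (List V →₀ K) :=
  Finsupp.linearCombination K (ρ.wordFAux i)

@[simp]
lemma wordF_single (i : V) (w : List V) : ρ.wordF i (Finsupp.single w 1) = ρ.wordFAux i w := by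
  simp [wordF]

lemma wordH_lie_wordE (x : 𝔥) (i : V) : ⁅ρ.wordH x, wordE K i⁆ = ρ.root i x • wordE K i :=
  word_hom_ext fun w => by simp [wordH_single, add_smul]

lemma wordH_wordE (x : 𝔥) (i : V) (m : List V →₀ K) :
    ρ.wordH x (wordE K i m) = wordE K i (ρ.wordH x m) + ρ.root i x • wordE K i m :=
  sub_eq_iff_eq_add'.1 (LinearMap.congr_fun (ρ.wordH_lie_wordE x i) m)

lemma wordH_wordFAux (x : 𝔥) (i : V) (w : List V) :
    ρ.wordH x (ρ.wordFAux i w) = ((w.map ρ.root).sum x - ρ.root i x) • ρ.wordFAux i w := by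
  induction w with
  | nil => simp [wordFAux]
  | cons j w ih =>
    rw [wordFAux, map_sub, wordH_wordE, ih, List.map_cons, List.sum_cons, LinearMap.add_apply,
      map_smul]
    split_ifs with hij
    · simp only [hij, wordH_single, map_smul]
      module
    · rw [map_zero]
      module

/-- The lowest weight Verma module of lowest weight zero. -/
noncomputable def wordChevalley : ρ.Chevalley (Module.End K (List V →₀ K)) where
  h := ρ.wordH
  e := wordE K
  f := ρ.wordF
  lie_h_h x y := word_hom_ext fun w => by
    simp only [LieRing.of_associative_ring_bracket, LinearMap.sub_apply, Module.End.mul_apply,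
      wordH_single, map_smul, smul_comm ((w.map ρ.root).sum y), sub_self, LinearMap.zero_apply]
  lie_e_f_self i := word_hom_ext fun w => by
    simp [LieRing.of_associative_ring_bracket, wordFAux]
  lie_e_f_of_ne i j hij := word_hom_ext fun w => by
    simp [LieRing.of_associative_ring_bracket, wordFAux, hij.symm]
  lie_h_e := ρ.wordH_lie_wordE
  lie_h_f x i := word_hom_ext fun w => by
    simp only [LieRing.of_associative_ring_bracket, LinearMap.sub_apply, Module.End.mul_apply,
      wordF_single, wordH_wordFAux, wordH_single, map_smul, LinearMap.smul_apply]
    module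

lemma serreE_swap_wordChevalley (hA : IsGeneralizedCartan A) {i j : V} (hij : i ≠ j) :
    ρ.wordChevalley.swap.serreE i j = 0 := by
  have hnil (n : ℕ) : (ad K (Module.End K (List V →₀ K)) (ρ.wordF i) ^ n) (ρ.wordF j)
      (Finsupp.single [] 1) = 0 := by
    induction n with
    | zero => simp [wordFAux]
    | succ n ih =>
      simp [pow_succ', LieRing.of_associative_ring_bracket, ih, wordFAux]
  refine word_hom_ext fun w => ?_
  induction w with
  | nil => exact hnil _
  | cons k w ih =>
    have hcomm : wordE K k (ρ.wordChevalley.swap.serreE i j (Finsupp.single w 1)) =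
        ρ.wordChevalley.swap.serreE i j (wordE K k (Finsupp.single w 1)) :=
      sub_eq_zero.1 (LinearMap.congr_fun (ρ.wordChevalley.swap.lie_f_serreE hA hij k) _)
    rw [← wordE_single, ← hcomm, ih, LinearMap.zero_apply, map_zero, LinearMap.zero_apply]

/-- The subspace of the free algebra on the letters `e i`, seen as the span of the words, that is
the two-sided ideal generated by the Serre elements. -/
noncomputable def serreSubmodule : Submodule K (List V →₀ K) :=
  Submodule.span K {x | ∃ (w : List V) (i j : V) (m : List V →₀ K), i ≠ j ∧
    x = (w.map (wordE K)).prod (ρ.wordChevalley.serreE i j m)}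

lemma serreE_apply_mem_serreSubmodule {i j : V} (hij : i ≠ j) (m : List V →₀ K) :
    ρ.wordChevalley.serreE i j m ∈ ρ.serreSubmodule :=
  Submodule.subset_span ⟨[], i, j, m, hij, by simp⟩

lemma wordE_mem_serreSubmodule (i : V) {m : List V →₀ K} (hm : m ∈ ρ.serreSubmodule) :
    wordE K i m ∈ ρ.serreSubmodule := by
  induction hm using Submodule.span_induction with
  | mem m h =>
    obtain ⟨w, j, k, m, hjk, rfl⟩ := h
    exact Submodule.subset_span ⟨i :: w, j, k, m, hjk, by simp⟩
  | zero => simp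
  | add m n _ _ hm hn => rw [map_add]; exact add_mem hm hn
  | smul c m _ hm => rw [map_smul]; exact Submodule.smul_mem _ c hm

lemma serreSubmodule_le {N : Submodule K (List V →₀ K)}
    (hserre : ∀ i j, i ≠ j → ∀ m, ρ.wordChevalley.serreE i j m ∈ N)
    (hE : ∀ k, ∀ m ∈ ρ.serreSubmodule, m ∈ N → wordE K k m ∈ N) : ρ.serreSubmodule ≤ N := by
  refine Submodule.span_le.2 ?_
  rintro _ ⟨w, i, j, m, hij, rfl⟩
  induction w with
  | nil => exact hserre i j hij m
  | cons k w ih => exact hE k _ (Submodule.subset_span ⟨w, i, j, m, hij, rfl⟩) ih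

lemma serreSubmodule_le_comap {φ : Module.End K (List V →₀ K)}
    (hserre : ∀ i j, i ≠ j → ∀ m, φ (ρ.wordChevalley.serreE i j m) ∈ ρ.serreSubmodule)
    (hE : ∀ k, ∀ m ∈ ρ.serreSubmodule, ⁅φ, wordE K k⁆ m ∈ ρ.serreSubmodule) :
    ρ.serreSubmodule ≤ ρ.serreSubmodule.comap φ := by
  refine ρ.serreSubmodule_le hserre fun k m hm hφm => ?_
  have h : φ (wordE K k m) - wordE K k (φ m) ∈ ρ.serreSubmodule := hE k m hm
  simpa only [sub_add_cancel, Submodule.mem_comap] using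
    add_mem h (ρ.wordE_mem_serreSubmodule k hφm)

lemma serreSubmodule_le_comap_wordH (x : 𝔥) :
    ρ.serreSubmodule ≤ ρ.serreSubmodule.comap (ρ.wordH x) := by
  refine ρ.serreSubmodule_le_comap (fun i j hij m => ?_) fun k m hm => ?_
  · have h : ρ.wordH x (ρ.wordChevalley.serreE i j m) = _ :=
      sub_eq_iff_eq_add.1 (LinearMap.congr_fun (ρ.wordChevalley.lie_h_serreE x i j) m)
    rw [h]
    exact add_mem (Submodule.smul_mem _ _ (ρ.serreE_apply_mem_serreSubmodule hij _))
      (ρ.serreE_apply_mem_serreSubmodule hij _)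
  · rw [wordH_lie_wordE]
    exact Submodule.smul_mem _ _ (ρ.wordE_mem_serreSubmodule k hm)

lemma serreSubmodule_le_comap_wordF (hA : IsGeneralizedCartan A) (k : V) :
    ρ.serreSubmodule ≤ ρ.serreSubmodule.comap (ρ.wordF k) := by
  refine ρ.serreSubmodule_le_comap (fun i j hij m => ?_) fun l m hm => ?_
  · have h : ρ.wordF k (ρ.wordChevalley.serreE i j m) = _ :=
      sub_eq_zero.1 (LinearMap.congr_fun (ρ.wordChevalley.lie_f_serreE hA hij k) m)
    rw [h]
    exact ρ.serreE_apply_mem_serreSubmodule hij _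
  · by_cases hlk : l = k
    · have h : ⁅ρ.wordF k, wordE K l⁆ = -ρ.wordH (ρ.coroot k) := by
        rw [hlk, ← lie_skew]
        exact congrArg Neg.neg (ρ.wordChevalley.lie_e_f_self k)
      rw [h]
      exact neg_mem (ρ.serreSubmodule_le_comap_wordH _ hm)
    · have h : ⁅ρ.wordF k, wordE K l⁆ = 0 := ρ.wordChevalley.lie_f_e_of_ne (Ne.symm hlk)
      rw [h]
      exact zero_mem _

/-- The Lie algebra of the operators that preserve `serreSubmodule`. -/
noncomputable def serreStabilizer : LieSubalgebra K (Module.End K (List V →₀ K)) where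
  carrier := {φ | ∀ m ∈ ρ.serreSubmodule, φ m ∈ ρ.serreSubmodule}
  add_mem' hφ hψ m hm := add_mem (hφ m hm) (hψ m hm)
  zero_mem' _ _ := zero_mem _
  smul_mem' c _ hφ m hm := Submodule.smul_mem _ c (hφ m hm)
  lie_mem' hφ hψ m hm := sub_mem (hφ _ (hψ m hm)) (hψ _ (hφ m hm))

/-- `serreSubmodule` as a submodule for the action of its stabilizer. -/
noncomputable def serreLieSubmodule : LieSubmodule K ρ.serreStabilizer (List V →₀ K) where
  __ := ρ.serreSubmodule
  lie_mem {φ} := φ.2 _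

/-- The operators of `wordChevalley` as elements of `serreStabilizer`. -/
noncomputable def stabilizerChevalley (hA : IsGeneralizedCartan A) :
    ρ.Chevalley ρ.serreStabilizer :=
  ρ.wordChevalley.codRestrict ρ.serreStabilizer ρ.serreSubmodule_le_comap_wordH
    (fun i _ => ρ.wordE_mem_serreSubmodule i) (ρ.serreSubmodule_le_comap_wordF hA)

lemma coe_serreE_stabilizerChevalley (hA : IsGeneralizedCartan A) (i j : V) :
    ((ρ.stabilizerChevalley hA).serreE i j : Module.End K (List V →₀ K)) =
      ρ.wordChevalley.serreE i j :=
  map_ad_pow ρ.serreStabilizer.incl _ _ _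

lemma serreE_swap_stabilizerChevalley (hA : IsGeneralizedCartan A) {i j : V} (hij : i ≠ j) :
    (ρ.stabilizerChevalley hA).swap.serreE i j = 0 :=
  Subtype.ext <| (map_ad_pow ρ.serreStabilizer.incl _ _ _).trans
    (ρ.serreE_swap_wordChevalley hA hij)

/-- The action on the quotient of the Verma module by `serreSubmodule`. -/
noncomputable def quotientChevalley (hA : IsGeneralizedCartan A) :
    ρ.Chevalley (Module.End K ((List V →₀ K) ⧸ ρ.serreLieSubmodule)) :=
  (ρ.stabilizerChevalley hA).map (LieModule.toEnd K ρ.serreStabilizer _)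

lemma toEnd_quotient_eq_zero {φ : ρ.serreStabilizer}
    (hφ : ∀ m, (φ : Module.End K (List V →₀ K)) m ∈ ρ.serreSubmodule) :
    LieModule.toEnd K ρ.serreStabilizer ((List V →₀ K) ⧸ ρ.serreLieSubmodule) φ = 0 := by
  refine LinearMap.ext fun m => ?_
  obtain ⟨m, rfl⟩ := LieSubmodule.Quotient.surjective_mk' _ m
  exact (LieSubmodule.Quotient.mk_eq_zero _).2 (hφ m)

lemma serreE_quotientChevalley (hA : IsGeneralizedCartan A) {i j : V} (hij : i ≠ j) :
    (ρ.quotientChevalley hA).serreE i j = 0 := by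
  refine (Chevalley.serreE_map _ _ i j).trans (ρ.toEnd_quotient_eq_zero fun m => ?_)
  rw [coe_serreE_stabilizerChevalley]
  exact ρ.serreE_apply_mem_serreSubmodule hij m

lemma serreE_swap_quotientChevalley (hA : IsGeneralizedCartan A) {i j : V} (hij : i ≠ j) :
    (ρ.quotientChevalley hA).swap.serreE i j = 0 := by
  have h := (ρ.stabilizerChevalley hA).swap.serreE_map
    (LieModule.toEnd K ρ.serreStabilizer ((List V →₀ K) ⧸ ρ.serreLieSubmodule)) i j
  rw [ρ.serreE_swap_stabilizerChevalley hA hij, map_zero] at h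
  exact h

section Evaluation

variable {B : Type*} [Ring B] [Algebra K B] (X : V → B)

variable (K) in
/-- The evaluation of the free algebra on the letters `e i`, seen as the span of the words. -/
noncomputable def wordEval : (List V →₀ K) →ₗ[K] B :=
  Finsupp.linearCombination K fun w => (w.map X).prod

lemma wordEval_wordE (i : V) (m : List V →₀ K) :
    wordEval K X (wordE K i m) = X i * wordEval K X m :=
  LinearMap.congr_fun (f := wordEval K X ∘ₗ wordE K i)
    (g := LinearMap.mulLeft K (X i) ∘ₗ wordEval K X)
    (word_hom_ext fun w => by simp [wordEval]) m

lemma wordEval_ad_pow (i j : V) (n : ℕ) (m : List V →₀ K) :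
    wordEval K X ((ad K (Module.End K (List V →₀ K)) (wordE K i) ^ n) (wordE K j) m) =
      (ad K B (X i) ^ n) (X j) * wordEval K X m := by
  induction n generalizing m with
  | zero => exact wordEval_wordE X j m
  | succ n ih =>
    simp only [pow_succ', Module.End.mul_apply, ad_apply, LieRing.of_associative_ring_bracket,
      LinearMap.sub_apply, map_sub, wordEval_wordE, ih, sub_mul, mul_assoc]

lemma serreSubmodule_le_ker_wordEval
    (hX : ∀ i j, i ≠ j → (ad K B (X i) ^ (1 - A i j).toNat) (X j) = 0) :
    ρ.serreSubmodule ≤ LinearMap.ker (wordEval K X) := by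
  refine ρ.serreSubmodule_le (fun i j hij m => ?_) fun k m _ hm => ?_
  · exact (wordEval_ad_pow X i j _ m).trans (by rw [hX i j hij, zero_mul])
  · rw [LinearMap.mem_ker, wordEval_wordE, LinearMap.mem_ker.1 hm, mul_zero]

lemma exists_lieHom_lieSpan {I L M : Type*} [LieRing L] [LieAlgebra K L] [AddCommGroup M]
    [Module K M] {γ : I → L} {x : I → B} (θ : L →ₗ⁅K⁆ Module.End K M) (π : M →ₗ[K] B) {v : M}
    (hv : π v = 1) (hγ : ∀ i m, π (θ (γ i) m) = x i * π m) :
    ∃ η : LieSubalgebra.lieSpan K L (Set.range γ) →ₗ⁅K⁆ B,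
      ∀ i, η ⟨γ i, LieSubalgebra.subset_lieSpan ⟨i, rfl⟩⟩ = x i := by
  -- Under `π` every `y` acts as left multiplication by `π (θ y v)`, so that `y ↦ π (θ y v)`
  -- preserves brackets.
  have hmul : ∀ y ∈ LieSubalgebra.lieSpan K L (Set.range γ),
      ∀ m, π (θ y m) = π (θ y v) * π m := by
    intro y hy
    induction hy using LieSubalgebra.lieSpan_induction with
    | mem y h =>
      obtain ⟨i, rfl⟩ := h
      intro m
      rw [hγ, hγ, hv, mul_one]
    | zero => simp
    | add y z _ _ hy hz =>
      intro m
      simp only [map_add, LinearMap.add_apply, add_mul, hy m, hz m]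
    | smul c y _ hy =>
      intro m
      simp only [map_smul, LinearMap.smul_apply, smul_mul_assoc, hy m]
    | lie y z _ _ hy hz =>
      intro m
      simp only [LieHom.map_lie, LieRing.of_associative_ring_bracket, LinearMap.sub_apply,
        Module.End.mul_apply, map_sub, hy (θ z _), hz (θ y _), hy m, hz m, sub_mul, mul_assoc]
  refine ⟨{ toFun y := π (θ y v), map_add' := by simp, map_smul' := by simp, map_lie' := ?_ },
    fun i => ?_⟩
  · intro y z
    simp only [LieSubalgebra.coe_bracket, LieHom.map_lie, LieRing.of_associative_ring_bracket,
      LinearMap.sub_apply, Module.End.mul_apply, map_sub, hmul y y.2 (θ z v),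
      hmul z z.2 (θ y v)]
  · exact (hγ i v).trans (by rw [hv, mul_one])

variable {X} (hA : IsGeneralizedCartan A)
  (hX : ∀ i j, i ≠ j → (ad K B (X i) ^ (1 - A i j).toNat) (X j) = 0)

include hA hX

lemma exists_algHom_lieSpan {γ : V → ρ.KacMoody}
    (θ : ρ.KacMoody →ₗ⁅K⁆ Module.End K ((List V →₀ K) ⧸ ρ.serreLieSubmodule))
    (hθ : ∀ i, θ (γ i) = (ρ.quotientChevalley hA).e i) :
    ∃ ψ : UniversalEnvelopingAlgebra K (LieSubalgebra.lieSpan K ρ.KacMoody (Set.range γ)) →ₐ[K] B,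
      ∀ i, ψ (UniversalEnvelopingAlgebra.ι K ⟨γ i, LieSubalgebra.subset_lieSpan ⟨i, rfl⟩⟩) =
        X i := by
  let π := ρ.serreSubmodule.liftQ (wordEval K X) (ρ.serreSubmodule_le_ker_wordEval X hX)
  have hv : π (ρ.serreSubmodule.mkQ (Finsupp.single [] 1)) = 1 :=
    (ρ.serreSubmodule.liftQ_apply _ _).trans (by simp [wordEval])
  have hγ (i : V) (m : (List V →₀ K) ⧸ ρ.serreLieSubmodule) : π (θ (γ i) m) = X i * π m := by
    obtain ⟨m, rfl⟩ := ρ.serreSubmodule.mkQ_surjective m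
    rw [hθ]
    exact wordEval_wordE X i m
  obtain ⟨η, hη⟩ := exists_lieHom_lieSpan θ π hv hγ
  exact ⟨UniversalEnvelopingAlgebra.lift K η, fun i => by
    rw [UniversalEnvelopingAlgebra.lift_ι_apply, hη]⟩

lemma exists_algHom_UPos : ∃ ψ : ρ.UPos →ₐ[K] B, ∀ i, ψ (ρ.eU i) = X i :=
  ρ.exists_algHom_lieSpan hA hX
    ((ρ.quotientChevalley hA).lift (fun _ _ => ρ.serreE_quotientChevalley hA)
      fun _ _ => ρ.serreE_swap_quotientChevalley hA)
    fun i => Chevalley.lift_gen _ _ _ (.e i)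

lemma exists_algHom_UNeg : ∃ ψ : ρ.UNeg →ₐ[K] B, ∀ i, ψ (ρ.fU i) = X i :=
  ρ.exists_algHom_lieSpan hA hX
    ((ρ.quotientChevalley hA).swap.lift (fun _ _ => ρ.serreE_swap_quotientChevalley hA)
      fun _ _ => ρ.serreE_quotientChevalley hA)
    fun i => Chevalley.lift_gen _ _ _ (.f i)

end Evaluation

end Realization

end WordModule

/-! ### Weight spaces -/

section Weights

lemma eq_of_iSupIndep_of_le_of_iSup_eq_top {ι α : Type*} [CompleteLattice α] [IsModularLattice α]
    {U W : ι → α} (hU : iSupIndep U) (hWU : ∀ c, W c ≤ U c) (hW : ⨆ c, W c = ⊤) (d : ι) :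
    U d = W d := by
  have htop : W d ⊔ ⨆ (c) (_ : c ≠ d), W c = ⊤ := by rw [← hW, ← iSup_split_single]
  have hdisj : (⨆ (c) (_ : c ≠ d), W c) ⊓ U d = ⊥ :=
    ((hU d).symm.mono_left (iSup₂_mono fun c _ => hWU c)).eq_bot
  calc
    U d = (W d ⊔ ⨆ (c) (_ : c ≠ d), W c) ⊓ U d := by rw [htop, top_inf_eq]
    _ = W d ⊔ (⨆ (c) (_ : c ≠ d), W c) ⊓ U d := (sup_inf_assoc_of_le _ (hWU d))
    _ = W d := by rw [hdisj, sup_bot_eq]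

section Leibniz

variable {K V 𝔥 B : Type*} [Field K] [AddCommGroup 𝔥] [Module K 𝔥] [Ring B] [Algebra K B]
  {D : 𝔥 → Module.End K B}
  (hmul : ∀ x b c, D x (b * c) = b * D x c + D x b * c) {a : V → B}
  {χ : (V →₀ ℤ) →ₗ[ℤ] Module.Dual K 𝔥}
  (hD : ∀ x i, D x (a i) = χ (Finsupp.single i 1) x • a i)

include hmul hD

lemma leibniz_prod_word (x : 𝔥) (w : List V) :
    D x (w.map a).prod = χ (wordDegree w) x • (w.map a).prod := by
  induction w with
  | nil =>
    have h : D x 1 = 0 := by simpa using hmul x 1 1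
    simp [h]
  | cons i w ih =>
    rw [List.map_cons, List.prod_cons, hmul, ih, hD, wordDegree_cons, map_add, LinearMap.add_apply,
      add_smul, mul_smul_comm, smul_mul_assoc, add_comm]

lemma iInf_ker_sub_smul_eq_wordSpan (hχ : Function.Injective χ)
    (ha : Algebra.adjoin K (Set.range a) = ⊤) (d : V →₀ ℤ) :
    ⨅ x, LinearMap.ker (D x - χ d x • LinearMap.id) = wordSpan K a d := by
  have hcomm (x y : 𝔥) : Commute (D x) (D y) := by
    refine LinearMap.ext_on_range (span_range_prod_eq_top K ha) fun w => ?_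
    simp only [Module.End.mul_apply, leibniz_prod_word hmul hD, map_smul, smul_smul, mul_comm]
  have hindepMax : iSupIndep fun c => ⨅ x, (D x).maxGenEigenspace (χ c x) :=
    (Module.End.independent_iInf_maxGenEigenspace_of_forall_mapsTo D fun x y φ =>
      Module.End.mapsTo_maxGenEigenspace_of_comm (hcomm y x) φ).comp
        (DFunLike.coe_injective.comp hχ)
  have hindep : iSupIndep fun c => ⨅ x, LinearMap.ker (D x - χ c x • LinearMap.id) :=
    hindepMax.mono fun c => iInf_mono fun x =>
      (D x).eigenspace_def.symm.trans_le Module.End.eigenspace_le_maxGenEigenspace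
  refine eq_of_iSupIndep_of_le_of_iSup_eq_top hindep (fun c => le_iInf fun x => ?_)
    (iSup_wordSpan_eq_top K ha) d
  refine Submodule.span_le.2 ?_
  rintro _ ⟨w, rfl, rfl⟩
  exact sub_eq_zero.2 (leibniz_prod_word hmul hD x w)

end Leibniz

section Adjoin

variable {K L : Type*} [Field K] [LieRing L] [LieAlgebra K L]

attribute [local instance] LieRing.ofAssociativeRing

lemma adjoin_ι_image_eq_top {s : Set L} (hs : LieSubalgebra.lieSpan K L s = ⊤) :
    Algebra.adjoin K (UniversalEnvelopingAlgebra.ι K '' s) = ⊤ := by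
  set S := Algebra.adjoin K (UniversalEnvelopingAlgebra.ι K '' s)
  have hι (x : L) : UniversalEnvelopingAlgebra.ι K x ∈ S := by
    have hx : x ∈ LieSubalgebra.lieSpan K L s := hs ▸ LieSubalgebra.mem_top x
    induction hx using LieSubalgebra.lieSpan_induction with
    | mem x h => exact Algebra.subset_adjoin ⟨x, h, rfl⟩
    | zero => rw [map_zero]; exact S.zero_mem
    | add x y _ _ hx hy => rw [map_add]; exact S.add_mem hx hy
    | smul c x _ hx => rw [map_smul]; exact S.smul_mem hx c
    | lie x y _ _ hx hy =>
      rw [LieHom.map_lie]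
      exact S.sub_mem (S.mul_mem hx hy) (S.mul_mem hy hx)
  let φ : L →ₗ⁅K⁆ S :=
    { toFun x := ⟨UniversalEnvelopingAlgebra.ι K x, hι x⟩
      map_add' x y := Subtype.ext (map_add _ x y)
      map_smul' c x := Subtype.ext (map_smul _ c x)
      map_lie' := Subtype.ext (LieHom.map_lie _ _ _) }
  have hid : S.val.comp (UniversalEnvelopingAlgebra.lift K φ) = AlgHom.id K _ :=
    UniversalEnvelopingAlgebra.hom_ext K <| LieHom.ext fun x =>
      congrArg S.val (UniversalEnvelopingAlgebra.lift_ι_apply K φ x)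
  refine Algebra.eq_top_iff.2 fun u => ?_
  rw [← AlgHom.id_apply (R := K) u, ← hid]
  exact Subtype.property _

lemma adjoin_range_ι_lieSpan_eq_top {V : Type*} (γ : V → L) :
    Algebra.adjoin K (Set.range fun i =>
      UniversalEnvelopingAlgebra.ι K (⟨γ i, LieSubalgebra.subset_lieSpan ⟨i, rfl⟩⟩ :
        LieSubalgebra.lieSpan K L (Set.range γ))) = ⊤ := by
  rw [← adjoin_ι_image_eq_top LieSubalgebra.lieSpan_lieSpan_coe_preimage]
  congr 1
  ext u
  constructor
  · rintro ⟨i, rfl⟩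
    exact ⟨_, ⟨i, rfl⟩, rfl⟩
  · rintro ⟨⟨_, _⟩, ⟨i, rfl⟩, rfl⟩
    exact ⟨i, rfl⟩

end Adjoin

namespace Realization

variable {K : Type*} [Field K] {V : Type*} {A : V → V → ℤ} {𝔥 : Type*} [AddCommGroup 𝔥]
  [Module K 𝔥] (ρ : Realization K A 𝔥)

lemma adjoin_range_eU : Algebra.adjoin K (Set.range ρ.eU) = ⊤ := adjoin_range_ι_lieSpan_eq_top _

lemma adjoin_range_fU : Algebra.adjoin K (Set.range ρ.fU) = ⊤ := adjoin_range_ι_lieSpan_eq_top _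

lemma envelopingDeriv_adPos_eU (x : 𝔥) (i : V) :
    envelopingDeriv (ρ.adPos x) (ρ.eU i) = ρ.root i x • ρ.eU i := by
  have h : ρ.adPos x (ρ.e i) = ρ.root i x • ρ.e i := Subtype.ext (ρ.h_lie_e x i)
  rw [eU, envelopingDeriv_ι, h, map_smul]

lemma envelopingDeriv_adNeg_fU (x : 𝔥) (i : V) :
    envelopingDeriv (ρ.adNeg x) (ρ.fU i) = (-ρ.root i x) • ρ.fU i := by
  have h : ρ.adNeg x (ρ.f i) = (-ρ.root i x) • ρ.f i := Subtype.ext (ρ.h_lie_f x i)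
  rw [fU, envelopingDeriv_ι, h, map_smul]

variable [CharZero K]

lemma linearCombination_root_injective :
    Function.Injective (Finsupp.linearCombination ℤ ρ.root) :=
  ρ.root_indep.restrict_scalars' ℤ

lemma posWeightSpace_eq_wordSpan (d : V →₀ ℤ) : ρ.posWeightSpace d = wordSpan K ρ.eU d := by
  refine iInf_ker_sub_smul_eq_wordSpan (fun x => envelopingDeriv_mul (ρ.adPos x)) (fun x i => ?_)
    ρ.linearCombination_root_injective ρ.adjoin_range_eU d
  rw [envelopingDeriv_adPos_eU, Finsupp.linearCombination_single, one_smul]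

lemma negWeightSpace_eq_wordSpan (d : V →₀ ℤ) :
    ρ.negWeightSpace d = wordSpan K ρ.fU (-d) := by
  have hneg (x : 𝔥) : ρ.weight d x = (-Finsupp.linearCombination ℤ ρ.root) (-d) x := by
    rw [LinearMap.neg_apply, map_neg, neg_neg]
    rfl
  simp only [negWeightSpace, hneg]
  refine iInf_ker_sub_smul_eq_wordSpan (fun x => envelopingDeriv_mul (ρ.adNeg x)) (fun x i => ?_)
    (neg_injective.comp ρ.linearCombination_root_injective) ρ.adjoin_range_fU (-d)
  rw [envelopingDeriv_adNeg_fU, LinearMap.neg_apply, Finsupp.linearCombination_single, one_smul,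
    LinearMap.neg_apply]

end Realization

end Weights

theorem theorem5p4 {K : Type*} [Field K] [CharZero K] {V E : Type*} (Γ : Multiquiver V E)
    {𝔥 : Type*} [AddCommGroup 𝔥] [Module K 𝔥] (ρ : Realization K Γ.cartan 𝔥) :
    (∃ ψ : ρ.UPos →ₐ[K] Γ.Alg K,
      (∀ i, ψ (ρ.eU i) = Γ.X K i) ∧
      (∀ d : V →₀ ℤ, ∀ x ∈ ρ.posWeightSpace d, ψ x ∈ Γ.algDeg K d) ∧
      ∀ i j : V, i ≠ j → ∀ k : ℕ, (k : ℤ) ≤ -Γ.cartan i j →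
        Set.InjOn ψ (ρ.posWeightSpace (Finsupp.single i (k : ℤ) + Finsupp.single j 1))) ∧
    (∃ ψ : ρ.UNeg →ₐ[K] Γ.Alg K,
      (∀ i, ψ (ρ.fU i) = Γ.Y K i) ∧
      (∀ d : V →₀ ℤ, ∀ x ∈ ρ.negWeightSpace d, ψ x ∈ Γ.algDeg K d) ∧
      ∀ i j : V, i ≠ j → ∀ k : ℕ, (k : ℤ) ≤ -Γ.cartan i j →
        Set.InjOn ψ (ρ.negWeightSpace (-(Finsupp.single i (k : ℤ)) - Finsupp.single j 1))) := by
  have hcartan := Γ.isGeneralizedCartan_cartan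
  constructor
  · obtain ⟨ψ, hψ⟩ := ρ.exists_algHom_UPos hcartan fun _ _ => Γ.serre_X (K := K)
    simp only [ρ.posWeightSpace_eq_wordSpan]
    refine ⟨ψ, hψ, fun d x hx => ?_, fun i j hij k hk => injOn_wordSpan ψ ρ.eU i j k ?_⟩
    · exact Γ.wordSpan_X_le_algDeg d (by simpa only [hψ] using map_mem_wordSpan K ψ hx)
    · simpa only [hψ] using Γ.linearIndependent_X_words hij hk
  · obtain ⟨ψ, hψ⟩ := ρ.exists_algHom_UNeg hcartan fun _ _ => Γ.serre_Y (K := K)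
    simp only [ρ.negWeightSpace_eq_wordSpan, neg_sub', neg_neg, sub_neg_eq_add]
    refine ⟨ψ, hψ, fun d x hx => ?_, fun i j hij k hk => injOn_wordSpan ψ ρ.fU i j k ?_⟩
    · exact Γ.wordSpan_Y_le_algDeg d (by simpa only [hψ] using map_mem_wordSpan K ψ hx)
    · simpa only [hψ] using Γ.linearIndependent_Y_words hij hk
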